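/- **Theorem.** Let $A$ be a Noetherian normal domain (for instance a Noetherian normal local domain $(A,m)$, or an $\mathbb N$-graded normal domain that is finitely generated over a field $A_0=K$, with $m=\bigoplus_{i>0}A_i$). Let $I_1,\dots,I_k$ be ideals of $A$ of pure height one (that is, each $I_i$ is proper and all associated primes of $A/I_i$ have height one) whose classes $[I_i]$ have finite order in the divisor class group $\mathrm{Cl}(A)$. Write $(-)^{*}=\mathrm{Hom}_A(-,A)$, and regard the reflexive hull $J^{**}$ of a nonzero ideal $J\subseteq A$ as an ideal of $A$ through the injection $J^{**}\hookrightarrow A^{**}=A$. Let $$B=\mathcal R_s(I_1,\dots,I_k)=\bigoplus_{n_1,\dots,n_k\in\mathbb N}(I_1^{n_1}\cdots I_k^{n_k})^{**}\,U_1^{n_1}\cdots U_k^{n_k}\subseteq A[U_1,\dots,U_k]$$ be the multi-symbolic Rees algebra. Then $B$ is a Cohen–Macaulay ring if and only if for all $n_1,\dots,n_k\in\mathbb N$ the ideal $(I_1^{n_1}\cdots I_k^{n_k})^{**}$ is a maximal Cohen–Macaulay $A$-module. Here a ring is Cohen–Macaulay if it is Noetherian and each of its localizations $R$ at a maximal ideal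 satisfies $\operatorname{depth}R=\dim R$. A finitely generated $A$-module $M$ is maximal Cohen–Macaulay if $M_{\mathfrak m}\neq 0$ and $\operatorname{depth}_{A_{\mathfrak m}}M_{\mathfrak m}=\dim A_{\mathfrak m}$ for every maximal ideal $\mathfrak m$ of $A$; for $A$ local this says $M \neq 0$ and $\operatorname{depth}M=\dim A$. -/

import Mathlib

open scoped nonZeroDivisors

namespace SymbolicRees

universe u v

/-! ### Cohen–Macaulay rings and maximal Cohen–Macaulay modules -/

section CohenMacaulay

/-- The depth of a module `M` over a local ring `R`: the supremum of the lengths of the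
`M`-regular sequences contained in the maximal ideal of `R`. -/
noncomputable def localDepth (R : Type u) [CommRing R] [IsLocalRing R]
    (M : Type v) [AddCommGroup M] [Module R M] : ℕ∞ :=
  ⨆ (rs : List R) (_ : (∀ r ∈ rs, r ∈ IsLocalRing.maximalIdeal R) ∧
    RingTheory.Sequence.IsRegular M rs), (rs.length : ℕ∞)

/-- A module `M` over a (Noetherian) local ring `R` is maximal Cohen–Macaulay if it is nonzero,
finitely generated, and `depth M = dim R`. -/
structure IsMaximalCMLocal (R : Type u) [CommRing R] [IsLocalRing R]
    (M : Type v) [AddCommGroup M] [Module R M] : Prop where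
  nontrivial : Nontrivial M
  finite : Module.Finite R M
  depth_eq : (localDepth R M : WithBot ℕ∞) = ringKrullDim R

/-- A finitely generated module `M` over a (Noetherian) ring `R` is maximal Cohen–Macaulay if
`M_𝔪` is a maximal Cohen–Macaulay `R_𝔪`-module for each maximal ideal `𝔪` of `R`. -/
structure IsMaximalCohenMacaulay (R : Type u) [CommRing R]
    (M : Type v) [AddCommGroup M] [Module R M] : Prop where
  finite : Module.Finite R M
  localized : ∀ (m : Ideal R) [m.IsMaximal],
    IsMaximalCMLocal (Localization.AtPrime m) (LocalizedModule m.primeCompl M)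

/-- A ring `R` is Cohen–Macaulay if it is Noetherian and `depth R_𝔪 = dim R_𝔪` for each
maximal ideal `𝔪` of `R`. -/
structure IsCohenMacaulayRing (R : Type u) [CommRing R] : Prop where
  noetherian : IsNoetherianRing R
  depth_eq : ∀ (m : Ideal R) [m.IsMaximal],
    (localDepth (Localization.AtPrime m) (Localization.AtPrime m) : WithBot ℕ∞) =
      ringKrullDim (Localization.AtPrime m)

end CohenMacaulay

/-! ### Ideals of pure height one, reflexive hulls, multi-symbolic Rees algebras -/

section Hull

variable {A : Type u} [CommRing A]

/-- An ideal `I` has pure height one if it is proper and every associated prime of `A ⧸ I` has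
height one. -/
structure IsPureHeightOne (I : Ideal A) : Prop where
  ne_top : I ≠ ⊤
  height_eq : ∀ p ∈ associatedPrimes A (A ⧸ I), p.height = 1

theorem IsPureHeightOne.ne_bot [IsDomain A] {I : Ideal A} (h : IsPureHeightOne I) : I ≠ ⊥ := by
  rintro rfl
  have hmem : (⊥ : Ideal A) ∈ associatedPrimes A (A ⧸ (⊥ : Ideal A)) := by
    refine ⟨Ideal.isPrime_bot, 1, ?_⟩
    have hc : (⊥ : Submodule A (A ⧸ (⊥ : Ideal A))).colon {1} = (⊥ : Ideal A) := by
      ext r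
      rw [Submodule.mem_colon_singleton, Submodule.mem_bot, Ideal.mem_bot, Algebra.smul_def,
        mul_one, Ideal.Quotient.algebraMap_eq, Ideal.Quotient.eq_zero_iff_mem, Ideal.mem_bot]
    rw [hc, (Ideal.isPrime_bot (α := A)).radical]
  have h1 := h.height_eq ⊥ hmem
  rw [Ideal.height_bot] at h1
  exact zero_ne_one h1

/-- The reflexive hull `I^{**}` of an ideal `I`, where `*` is `Hom_A(-, A)`, as an ideal of `A`:
the image of the map `I^{**} → A^{**} = A` induced by the inclusion `ι : I → A`. Since
`A^{**} = A` is evaluation at the identity of `A`, this map sends `φ : I^* → A` to `φ ι`. (It is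
injective if `A` is a domain and `I ≠ 0`.) -/
def reflexiveHull (I : Ideal A) : Ideal A :=
  LinearMap.range (Module.Dual.eval A (Module.Dual A I) I.subtype)

theorem le_reflexiveHull (I : Ideal A) : I ≤ reflexiveHull I := fun x hx =>
  ⟨Module.Dual.eval A I ⟨x, hx⟩, rfl⟩

theorem mul_mem_reflexiveHull {I J : Ideal A} {x y : A} (hx : x ∈ reflexiveHull I)
    (hy : y ∈ reflexiveHull J) : x * y ∈ reflexiveHull (I * J) := by
  obtain ⟨φ, rfl⟩ := hx
  obtain ⟨ψ, rfl⟩ := hy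
  let c : I →ₗ[A] J →ₗ[A] (I * J : Ideal A) :=
    LinearMap.mk₂ A (fun i j => ⟨i * j, Ideal.mul_mem_mul i.2 j.2⟩)
      (fun _ _ _ => Subtype.ext (add_mul _ _ _)) (fun _ _ _ => Subtype.ext (mul_assoc _ _ _))
      (fun _ _ _ => Subtype.ext (mul_add _ _ _))
      (fun _ _ _ => Subtype.ext (mul_left_comm _ _ _))
  let g (f : Module.Dual A (I * J : Ideal A)) : Module.Dual A I :=
    ψ.comp ((LinearMap.llcomp A J (I * J : Ideal A) A f).comp c)
  have hg (f i) : g f i = ψ (f.comp (c i)) := rfl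
  let χ : Module.Dual A (Module.Dual A (I * J : Ideal A)) :=
    { toFun := fun f => φ (g f)
      map_add' := fun f f' => by
        rw [← map_add]
        congr 1
        ext i
        rw [LinearMap.add_apply, hg, hg, hg, LinearMap.add_comp, map_add]
      map_smul' := fun a f => by
        rw [RingHom.id_apply, ← map_smul]
        congr 1
        ext i
        rw [LinearMap.smul_apply, hg, hg, LinearMap.smul_comp, map_smul] }
  refine ⟨χ, ?_⟩
  have hι : g (I * J : Ideal A).subtype = ψ J.subtype • I.subtype := by
    ext i
    have : (I * J : Ideal A).subtype.comp (c i) = (i : A) • J.subtype := by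
      ext j
      rfl
    rw [hg, this, map_smul, LinearMap.smul_apply, smul_eq_mul, smul_eq_mul, mul_comm]
    rfl
  change φ (g (I * J : Ideal A).subtype) = φ I.subtype * ψ J.subtype
  rw [hι, map_smul, smul_eq_mul, mul_comm]

/-- The multi-symbolic Rees algebra
`⊕_{n ∈ ℕ^k} (I_1^{n_1} ⋯ I_k^{n_k})^{**} U_1^{n_1} ⋯ U_k^{n_k}` as a subalgebra of
`A[U_1, …, U_k]`: the polynomials whose coefficient at each monomial `U^n` lies in
`(I_1^{n_1} ⋯ I_k^{n_k})^{**}`. -/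
def multiSymbolicRees {k : ℕ} (I : Fin k → Ideal A) : Subalgebra A (MvPolynomial (Fin k) A) where
  carrier := {f | ∀ n : Fin k →₀ ℕ, f.coeff n ∈ reflexiveHull (∏ i, I i ^ n i)}
  mul_mem' {f g} hf hg n := by
    classical
    rw [MvPolynomial.coeff_mul]
    refine Ideal.sum_mem _ fun x hx => ?_
    rw [← Finset.HasAntidiagonal.mem_antidiagonal.mp hx]
    simpa only [Finsupp.add_apply, pow_add, Finset.prod_mul_distrib] using
      mul_mem_reflexiveHull (hf x.1) (hg x.2)
  add_mem' {f g} hf hg n := by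
    rw [MvPolynomial.coeff_add]
    exact Ideal.add_mem _ (hf n) (hg n)
  algebraMap_mem' r n := by
    classical
    rw [MvPolynomial.algebraMap_eq, MvPolynomial.coeff_C]
    split_ifs with h
    · subst h
      exact le_reflexiveHull _ (by simp [-Ideal.one_eq_top])
    · exact Ideal.zero_mem _

end Hull

/-! ### The divisor class group -/

section DivisorClassGroup

variable (A : Type u) [CommRing A] [IsDomain A]

instance : NoZeroDivisors (FractionalIdeal A⁰ (FractionRing A)) where
  eq_zero_or_eq_zero_of_mul_eq_zero {I J} h := by
    by_contra! hIJ
    obtain ⟨x, hx0, hx⟩ := (Submodule.ne_bot_iff _).mp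
      (mt FractionalIdeal.coeToSubmodule_eq_bot.mp hIJ.1)
    obtain ⟨y, hy0, hy⟩ := (Submodule.ne_bot_iff _).mp
      (mt FractionalIdeal.coeToSubmodule_eq_bot.mp hIJ.2)
    have hxy := FractionalIdeal.mul_mem_mul (I := I) (J := J) hx0 hy0
    rw [h, FractionalIdeal.mem_zero_iff] at hxy
    exact mul_ne_zero hx hy hxy

theorem mem_one_div_iff {I : FractionalIdeal A⁰ (FractionRing A)} (hI : I ≠ 0)
    {x : FractionRing A} :
    x ∈ 1 / I ↔ ∀ y ∈ I, x * y ∈ (1 : FractionalIdeal A⁰ (FractionRing A)) :=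
  FractionalIdeal.mem_div_iff_of_ne_zero hI

theorem mem_one_div_mul_iff {I J : FractionalIdeal A⁰ (FractionRing A)} (hI : I ≠ 0)
    (hJ : J ≠ 0) {x : FractionRing A} :
    x ∈ 1 / (I * J) ↔ ∀ y ∈ J, x * y ∈ 1 / I := by
  rw [mem_one_div_iff A (mul_ne_zero hI hJ)]
  simp only [mem_one_div_iff A hI]
  refine ⟨fun h y hy z hz => ?_, fun h w hw => ?_⟩
  · have := h (z * y) (FractionalIdeal.mul_mem_mul hz hy)
    rwa [mul_assoc, mul_comm y z]
  · refine FractionalIdeal.mul_induction_on hw (fun z hz y hy => ?_) (fun a b ha hb => ?_)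
    · have := h y hy z hz
      rwa [mul_assoc, mul_comm y z] at this
    · rw [mul_add]
      exact Submodule.add_mem _ ha hb

theorem one_div_mul_congr {I I' J : FractionalIdeal A⁰ (FractionRing A)} (hI : I ≠ 0)
    (hI' : I' ≠ 0) (hJ : J ≠ 0) (h : 1 / I = 1 / I') : 1 / (I * J) = 1 / (I' * J) := by
  ext x
  rw [mem_one_div_mul_iff A hI hJ, mem_one_div_mul_iff A hI' hJ, h]

/-- Artin equivalence of nonzero fractional ideals: `𝔞 ∼ 𝔟` if `(A : 𝔞) = (A : 𝔟)`, equivalently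
if `𝔞` and `𝔟` have the same reflexive (divisorial) hull `(A : (A : 𝔞)) = (A : (A : 𝔟))`. It is
compatible with products. -/
noncomputable def divisorCon : Con (FractionalIdeal A⁰ (FractionRing A))⁰ where
  r I J := 1 / (I : FractionalIdeal A⁰ (FractionRing A)) =
    1 / (J : FractionalIdeal A⁰ (FractionRing A))
  iseqv := ⟨fun _ => rfl, Eq.symm, Eq.trans⟩
  mul' {I I' J J'} h h' := by
    have hI := nonZeroDivisors.ne_zero I.2
    have hI' := nonZeroDivisors.ne_zero I'.2
    have hJ := nonZeroDivisors.ne_zero J.2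
    have hJ' := nonZeroDivisors.ne_zero J'.2
    change 1 / ((I : FractionalIdeal A⁰ (FractionRing A)) * J) =
      1 / ((I' : FractionalIdeal A⁰ (FractionRing A)) * J')
    rw [one_div_mul_congr A hI hI' hJ h, mul_comm, one_div_mul_congr A hJ hJ' hI' h', mul_comm]

/-- The divisors of `A`: nonzero fractional ideals up to Artin equivalence. Each class contains
exactly one divisorial (i.e. reflexive) fractional ideal, and the product of the classes of `𝔞`
and `𝔟` is the class of `(𝔞𝔟)^{**}`. -/
def Divisor : Type u := (divisorCon A).Quotient

noncomputable instance : CommMonoid (Divisor A) :=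
  inferInstanceAs (CommMonoid (divisorCon A).Quotient)

/-- The divisor of a nonzero fractional ideal. -/
noncomputable def Divisor.mk : (FractionalIdeal A⁰ (FractionRing A))⁰ →* Divisor A :=
  (divisorCon A).mk'

/-- The divisor of a nonzero element of the fraction field. -/
noncomputable def principalDivisor : (FractionRing A)ˣ →* Divisor A where
  toFun x := Divisor.mk A ⟨FractionalIdeal.spanSingleton A⁰ (x : FractionRing A),
    mem_nonZeroDivisors_of_ne_zero (FractionalIdeal.spanSingleton_ne_zero_iff.mpr x.ne_zero)⟩
  map_one' := by
    rw [← map_one (Divisor.mk A)]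
    congr 1
    exact Subtype.ext FractionalIdeal.spanSingleton_one
  map_mul' x y := by
    rw [← map_mul (Divisor.mk A)]
    congr 1
    exact Subtype.ext (FractionalIdeal.spanSingleton_mul_spanSingleton (x : FractionRing A) y).symm

section Group

theorem one_div_ne_zero {I : FractionalIdeal A⁰ (FractionRing A)} (hI : I ≠ 0) : 1 / I ≠ 0 := by
  obtain ⟨a, J, ha, rfl⟩ := FractionalIdeal.exists_eq_spanSingleton_mul I
  intro h
  have hmem : algebraMap A (FractionRing A) a ∈
      1 / (FractionalIdeal.spanSingleton A⁰ (algebraMap A (FractionRing A) a)⁻¹ *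
        (J : FractionalIdeal A⁰ (FractionRing A))) := by
    rw [mem_one_div_iff A hI]
    intro y hy
    obtain ⟨z, hz, rfl⟩ := FractionalIdeal.mem_singleton_mul.mp hy
    rw [mul_inv_cancel_left₀ (by simpa using ha)]
    exact FractionalIdeal.coeIdeal_le_one hz
  rw [h, FractionalIdeal.mem_zero_iff] at hmem
  exact ha (by simpa using hmem)

variable [IsNoetherianRing A] [IsIntegrallyClosed A]

theorem one_div_mul_one_div {I : FractionalIdeal A⁰ (FractionRing A)} (hI : I ≠ 0) :
    1 / (I * (1 / I)) = 1 := by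
  have hI' := one_div_ne_zero A hI
  apply le_antisymm
  · intro x hx
    replace hx : x ∈ 1 / (I * (1 / I)) := hx
    rw [mem_one_div_mul_iff A hI hI'] at hx
    have hint : IsIntegral A x := by
      refine isIntegral_of_smul_mem_submodule ((1 / I : FractionalIdeal A⁰ (FractionRing A)) :
        Submodule A (FractionRing A)) ?_ ?_ x hx
      · exact mt FractionalIdeal.coeToSubmodule_eq_bot.mp hI'
      · exact (isNoetherian_submodule.mp (FractionalIdeal.isNoetherian (1 / I))) _ le_rfl
    obtain ⟨a, rfl⟩ := IsIntegrallyClosed.isIntegral_iff.mp hint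
    exact FractionalIdeal.coe_mem_one A⁰ a
  · rw [FractionalIdeal.le_div_iff_mul_le (mul_ne_zero hI hI'), one_mul]
    exact FractionalIdeal.mul_one_div_le_one

/-- Over a Noetherian normal domain, the divisors form a group: the inverse of the class of `𝔞` is
the class of `(A : 𝔞)`. -/
noncomputable instance : CommGroup (Divisor A) :=
  { (inferInstance : CommMonoid (Divisor A)) with
    inv := Quotient.map'
      (fun I => ⟨1 / (I : FractionalIdeal A⁰ (FractionRing A)),
        mem_nonZeroDivisors_of_ne_zero (one_div_ne_zero A (nonZeroDivisors.ne_zero I.2))⟩)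
      (fun _ _ h => congrArg (fun L => 1 / L) h)
    inv_mul_cancel := fun d => by
      induction d using Quotient.inductionOn' with
      | h I =>
        refine (divisorCon A).eq.mpr ?_
        change 1 / (1 / (I : FractionalIdeal A⁰ (FractionRing A)) * I) = 1 / 1
        rw [mul_comm, one_div_mul_one_div A (nonZeroDivisors.ne_zero I.2),
          FractionalIdeal.div_one] }

/-- The divisor class group `Cl(A)` of a Noetherian normal domain `A` (written multiplicatively):
the group of divisors modulo the principal divisors. -/
abbrev DivisorClassGroup : Type u := Divisor A ⧸ (principalDivisor A).range

variable {A}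

/-- The class `[I]` in `Cl(A)` of a nonzero ideal `I` of `A`. -/
noncomputable def divisorClass (I : Ideal A) (hI : I ≠ ⊥) : DivisorClassGroup A :=
  QuotientGroup.mk (Divisor.mk A ⟨(I : FractionalIdeal A⁰ (FractionRing A)),
    mem_nonZeroDivisors_of_ne_zero (FractionalIdeal.coeIdeal_ne_zero.mpr hI)⟩)

end Group

end DivisorClassGroup

end SymbolicRees

/-! As the classes have finite order, there are r > 0 and nonzero f_j such that every I_j^r has the
same dual as f_j A. A reflexive hull depends only on the dual, so the hull in degree r e + n is f^e
times the hull in degree n (`mem_coeffIdeal_add_mul_iff`): up to isomorphism only the finitely many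
hulls with all n_j < r occur. Put T_j = f_j U_j^r and let N be the sum of the components of B with
all exponents below r. Then B is the direct sum of the T^e N, that is, N[T_1, …, T_k] as a module
over A[T_1, …, T_k], and it is finite over that ring. So B is Cohen–Macaulay exactly when N has full
depth over A.

Depths are compared through height sequences instead of dimension formulas. On a module of full
depth every height sequence is weakly regular, and conversely one weakly regular sequence as long as
the height of the prime is enough; `localDepth_eq_tfae` states this with elements of the ring before
localization.

If the hulls are maximal Cohen–Macaulay, a height sequence in a prime of A is regular there on all
components at once, hence on N. The T_j are adjoined one at a time
(`HasRegularSequences.polynomialModule`), and finiteness of B over A[T] brings the sequences to B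
(`IsFiniteRegularOver.isCohenMacaulayRing`).

If B is Cohen–Macaulay, let 𝔐 be the preimage of a maximal ideal 𝔪 of A under the projection of B to
degree zero. Then T_1, …, T_k followed by a height sequence in 𝔪 is a height sequence in 𝔐, so it is
regular there. Reading off the coefficient of U^n modulo the T_j, for n_j < r, shows that its tail
is regular on the hull in degree n. -/

namespace SymbolicRees

universe u v

open scoped nonZeroDivisors Pointwise
open IsLocalRing RingTheory.Sequence CategoryTheory Abelian

/-! ### Regular sequences and associated primes over a local ring -/

section Depth

variable {R : Type u} [CommRing R] [IsLocalRing R] [IsNoetherianRing R]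

/-- Dividing out a regular element of the maximal ideal lowers the depth by at most one. -/
theorem exists_isRegular_quotSMulTop {M : Type u} [AddCommGroup M] [Module R M]
    [Module.Finite R M] {rs : List R} (hmem : ∀ r ∈ rs, r ∈ maximalIdeal R)
    (hreg : IsRegular M rs) {n : ℕ} (hn : rs.length = n + 1) {x : R} (hx : x ∈ maximalIdeal R)
    (hxM : IsSMulRegular M x) :
    ∃ rs' : List R, rs'.length = n ∧ (∀ r ∈ rs', r ∈ maximalIdeal R) ∧
      IsRegular (QuotSMulTop x M) rs' := by
  have hnt : Nontrivial M := hreg.nontrivial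
  have hlt (N : Type u) [AddCommGroup N] [Module R N] [Module.Finite R N] [Nontrivial N] :
      maximalIdeal R • (⊤ : Submodule R (ModuleCat.of R N)) < ⊤ :=
    lt_top_iff_ne_top.mpr (Submodule.top_ne_ideal_smul_of_le_jacobson_annihilator
      (M := N) (maximalIdeal_le_jacobson _)).symm
  have hnt' : Nontrivial (QuotSMulTop x M) := nontrivial_quotSMulTop_of_mem_maximalIdeal M hx
  have hsupp : Module.support R (ModuleCat.of R (R ⧸ maximalIdeal R)) =
      PrimeSpectrum.zeroLocus (maximalIdeal R) := by
    rw [Module.support_eq_zeroLocus, Ideal.annihilator_quotient]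
  have h1 := ModuleCat.subsingleton_ext_of_exists_isRegular (maximalIdeal R)
    (ModuleCat.of R (R ⧸ maximalIdeal R)) hsupp.subset (ModuleCat.of R M) (hlt M) rs hmem hreg
  rw [hn] at h1
  refine ModuleCat.exists_isRegular_of_exists_subsingleton_ext (maximalIdeal R) n
    (ModuleCat.of R (QuotSMulTop x M)) (hlt _) (ModuleCat.of R (R ⧸ maximalIdeal R)) hsupp
    fun i hi => ?_
  -- In the long exact sequence of multiplication by x, Ext^i(k, M/xM) lies between Ext^i(k, M) and
  -- Ext^{i+1}(k, M). Both vanish for i < n.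
  have zero1 := AddCommGrpCat.isZero_of_iff_subsingleton.mpr (h1 i (by omega))
  have zero2 := AddCommGrpCat.isZero_of_iff_subsingleton.mpr (h1 (i + 1) (by omega))
  have hxM' : IsSMulRegular (ModuleCat.of R M) x := hxM
  exact AddCommGrpCat.subsingleton_of_isZero <| ShortComplex.Exact.isZero_of_both_zeros
    ((Ext.covariant_sequence_exact₃' _ hxM'.smulShortComplex_shortExact) i (i + 1) rfl)
    (zero1.eq_zero_of_src _) (zero2.eq_zero_of_tgt _)

/-- If `x` is `M`-regular, every associated prime of `M` is contained in an associated prime of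
`M ⧸ xM` that contains `x`. -/
theorem exists_lt_isAssociatedPrime_quotSMulTop {M : Type v} [AddCommGroup M] [Module R M]
    [Module.Finite R M] {x : R} (hx : x ∈ maximalIdeal R) (hxM : IsSMulRegular M x)
    {p : Ideal R} (hp : IsAssociatedPrime p M) :
    ∃ q, IsAssociatedPrime q (QuotSMulTop x M) ∧ p < q := by
  obtain ⟨hpp, y, hy⟩ := isAssociatedPrime_iff.mp hp
  -- L is the part of M killed by p. By Nakayama some l in L is not in xL; since x is regular, l is
  -- not in xM either. The class of l is then nonzero and killed by both p and x, while x is not in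
  -- p.
  let L : Submodule R M :=
    { carrier := {m | ∀ r ∈ p, r • m = 0}
      add_mem' := fun ha hb r hr => by rw [smul_add, ha r hr, hb r hr, add_zero]
      zero_mem' := fun r _ => smul_zero r
      smul_mem' := fun c m hm r hr => by rw [smul_comm, hm r hr, smul_zero] }
  have hyL : y ∈ L := fun r hr => by
    rw [hy, Submodule.mem_colon_singleton] at hr
    exact hr
  have hy0 : y ≠ 0 := by
    rintro rfl
    exact hpp.ne_top (by rw [hy]; ext; simp)
  have hLnt : Nontrivial L := ⟨⟨⟨y, hyL⟩, 0, fun h => hy0 (congrArg Subtype.val h)⟩⟩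
  have hLx := Submodule.top_ne_pointwise_smul_of_mem_jacobson_annihilator (M := L)
    (maximalIdeal_le_jacobson _ hx)
  obtain ⟨l, hl⟩ : ∃ l : L, l ∉ x • (⊤ : Submodule R L) := by
    by_contra! h
    exact hLx (top_le_iff.mp fun l _ => h l).symm
  have hne : (Submodule.Quotient.mk (l : M) : QuotSMulTop x M) ≠ 0 := by
    intro h
    obtain ⟨m, -, hm⟩ := (Submodule.Quotient.mk_eq_zero _).mp h
    have hm : x • m = l := hm
    have hmL : m ∈ L := fun r hr => hxM (by
      change x • r • m = x • 0
      rw [smul_comm, hm, smul_zero, l.2 r hr])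
    exact hl ⟨⟨m, hmL⟩, trivial, Subtype.ext hm⟩
  obtain ⟨q, hq, hle⟩ := exists_le_isAssociatedPrime_of_isNoetherianRing R _ hne
  have hpq : p ≤ q := fun r hr => hle (by
    rw [Submodule.mem_colon_singleton, ← Submodule.Quotient.mk_smul, l.2 r hr]
    exact zero_mem _)
  have hxq : x ∈ q := hle (by
    rw [Submodule.mem_colon_singleton, ← Submodule.Quotient.mk_smul]
    exact (Submodule.Quotient.mk_eq_zero _).mpr ⟨l, trivial, rfl⟩)
  refine ⟨q, hq, lt_of_le_not_ge hpq fun h => hy0 (hxM ?_)⟩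
  have := h hxq
  rw [hy, Submodule.mem_colon_singleton] at this
  change x • y = x • 0
  rw [smul_zero]
  exact this

/-- The height of an associated prime of `M` plus the length of an `M`-regular sequence is at most
the dimension. -/
theorem height_add_length_le {M : Type v} [AddCommGroup M] [Module R M] [Module.Finite R M]
    {rs : List R} (hmem : ∀ r ∈ rs, r ∈ maximalIdeal R) (hreg : IsWeaklyRegular M rs)
    {p : Ideal R} (hp : IsAssociatedPrime p M) :
    p.height + rs.length ≤ (maximalIdeal R).height := by
  induction rs generalizing M p with
  | nil =>
    have := hp.isPrime
    simpa using Ideal.height_mono (le_maximalIdeal hp.isPrime.ne_top)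
  | cons x rs ih =>
    rw [isWeaklyRegular_cons_iff] at hreg
    obtain ⟨q, hq, hpq⟩ :=
      exists_lt_isAssociatedPrime_quotSMulTop (hmem x List.mem_cons_self) hreg.1 hp
    have := hp.isPrime
    have := hq.isPrime
    have h1 := Ideal.height_add_one_le_of_lt_of_isPrime hpq
    have h2 := ih (fun r hr => hmem r (List.mem_cons_of_mem _ hr)) hreg.2 hq
    rw [List.length_cons, Nat.cast_add, Nat.cast_one, add_comm (rs.length : ℕ∞), ← add_assoc]
    exact (add_le_add_left h1 _).trans h2

end Depth

/-! ### Height sequences and full depth -/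

/-- A sequence each of whose initial segments of length `i` generates an ideal of height at least
`i`. -/
def IsHeightSequence {R : Type u} [CommRing R] (rs : List R) : Prop :=
  ∀ i ≤ rs.length, ∀ q : Ideal R, q.IsPrime → Ideal.ofList (rs.take i) ≤ q → (i : ℕ∞) ≤ q.height

section Depth

variable {R : Type u} [CommRing R] [IsLocalRing R] [IsNoetherianRing R]

/-- If x killed a nonzero element of M, some associated prime q would contain J and x, so its height
would be at least c + 1; but `height_add_length_le` bounds that height by c. J and c exist for the
induction: they record what has been divided out of the module and how many elements that took. -/
theorem isWeaklyRegular_of_le_height {M : Type u} [AddCommGroup M] [Module R M]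
    [Module.Finite R M] {J : Ideal R} (hJ : ∀ j ∈ J, ∀ m : M, j • m = 0) {c : ℕ} {ss : List R}
    (hss : ∀ r ∈ ss, r ∈ maximalIdeal R) (hreg : IsRegular M ss)
    (hdim : (maximalIdeal R).height ≤ c + ss.length) {rs : List R}
    (hmem : ∀ r ∈ rs, r ∈ maximalIdeal R) (hJm : J ≤ maximalIdeal R)
    (hrs : ∀ i ≤ rs.length, ∀ q : Ideal R, q.IsPrime → J ⊔ Ideal.ofList (rs.take i) ≤ q →
      ((c + i : ℕ) : ℕ∞) ≤ q.height) :
    IsWeaklyRegular M rs := by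
  induction rs generalizing M J c ss with
  | nil => exact IsWeaklyRegular.nil R M
  | cons x rs ih =>
    have hxm := hmem x List.mem_cons_self
    have hfin : (maximalIdeal R).height ≠ ⊤ := ne_top_of_le_ne_top (by simp) hdim
    have hx : IsSMulRegular M x := by
      rw [isSMulRegular_iff_right_eq_zero_of_smul]
      by_contra! h
      obtain ⟨m, hm, hm0⟩ := h
      obtain ⟨q, hq, hle⟩ := exists_le_isAssociatedPrime_of_isNoetherianRing R m hm0
      have h1 := height_add_length_le hss hreg.1 hq
      have h2 := hrs 1 (by simp) q hq.isPrime (sup_le (fun j hj => hle (by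
        rw [Submodule.mem_colon_singleton, hJ j hj]; exact zero_mem _)) (by
        simp only [List.take_succ_cons, List.take_zero, Ideal.ofList_singleton]
        rw [Ideal.span_singleton_le_iff_mem]
        exact hle (by rw [Submodule.mem_colon_singleton, hm]; exact zero_mem _)))
      have h3 := (add_le_add_left h2 _).trans (h1.trans hdim)
      norm_cast at h3
      omega
    -- If ss were empty, the maximal ideal, which contains J and x, would have height both at most c
    -- and at least c + 1.
    obtain ⟨n, hn⟩ : ∃ n, ss.length = n + 1 := by
      refine Nat.exists_eq_succ_of_ne_zero fun h0 => ?_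
      have h2 := hrs 1 (by simp) (maximalIdeal R) inferInstance (sup_le hJm (by
        simp only [List.take_succ_cons, List.take_zero, Ideal.ofList_singleton]
        rwa [Ideal.span_singleton_le_iff_mem]))
      have h3 := h2.trans hdim
      norm_cast at h3
      omega
    obtain ⟨ss', hlen, hss', hreg'⟩ := exists_isRegular_quotSMulTop hss hreg hn hxm hx
    refine (isWeaklyRegular_cons_iff _ _ _).mpr ⟨hx, ih (J := J ⊔ Ideal.span {x}) (c := c + 1)
      ?_ hss' hreg' ?_ (fun r hr => hmem r (List.mem_cons_of_mem _ hr)) ?_ ?_⟩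
    · intro j hj m
      obtain ⟨m, rfl⟩ := Submodule.Quotient.mk_surjective _ m
      obtain ⟨a, ha, b, hb, rfl⟩ := Submodule.mem_sup.mp hj
      obtain ⟨b, rfl⟩ := Ideal.mem_span_singleton'.mp hb
      rw [← Submodule.Quotient.mk_smul, add_smul, hJ a ha, zero_add, Submodule.Quotient.mk_eq_zero,
        mul_comm, mul_smul]
      exact ⟨b • m, trivial, rfl⟩
    · rw [hn] at hdim
      rw [hlen]
      refine hdim.trans (le_of_eq ?_)
      push_cast
      ring
    · exact sup_le hJm (by rwa [Ideal.span_singleton_le_iff_mem])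
    · intro i hi q hq hle
      have := hrs (i + 1) (by simpa using hi) q hq (by
        rwa [List.take_succ_cons, Ideal.ofList_cons, ← sup_assoc])
      rwa [add_assoc, add_comm 1 i]

/-- Over a Noetherian local ring, height sequences in the maximal ideal are weakly regular on
maximal Cohen–Macaulay modules. -/
theorem IsHeightSequence.isWeaklyRegular {M : Type u} [AddCommGroup M] [Module R M]
    [Module.Finite R M] {ss : List R} (hss : ∀ r ∈ ss, r ∈ maximalIdeal R) (hreg : IsRegular M ss)
    (hdim : (maximalIdeal R).height ≤ ss.length) {rs : List R}
    (hmem : ∀ r ∈ rs, r ∈ maximalIdeal R) (hrs : IsHeightSequence rs) :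
    IsWeaklyRegular M rs :=
  isWeaklyRegular_of_le_height (J := ⊥) (c := 0) (by simp) hss hreg (by simpa using hdim) hmem
    bot_le (by simpa [IsHeightSequence] using hrs)

/-- `height_add_length_le` already bounds the depth by the height of the maximal ideal, so one long
enough sequence decides. Weak regularity suffices by Nakayama. -/
theorem localDepth_eq_iff {M : Type u} [AddCommGroup M] [Module R M] [Module.Finite R M]
    [Nontrivial M] :
    (localDepth R M : WithBot ℕ∞) = ringKrullDim R ↔
      ∃ rs : List R, (∀ r ∈ rs, r ∈ maximalIdeal R) ∧ IsWeaklyRegular M rs ∧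
        (maximalIdeal R).height ≤ rs.length := by
  rw [← maximalIdeal_height_eq_ringKrullDim, WithBot.coe_inj]
  have hle {rs : List R} (h1 : ∀ r ∈ rs, r ∈ maximalIdeal R) (h2 : IsWeaklyRegular M rs) :
      (rs.length : ℕ∞) ≤ (maximalIdeal R).height := by
    obtain ⟨p, hp⟩ := associatedPrimes.nonempty R M
    exact le_add_self.trans (height_add_length_le h1 h2 hp)
  constructor
  · intro h
    have hfin : (maximalIdeal R).height ≠ ⊤ := Ideal.height_ne_top_of_isPrime
    obtain ⟨d, hd⟩ := ENat.ne_top_iff_exists.mp hfin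
    by_contra! hcon
    rcases d with _ | d
    · exact absurd (hcon [] (by simp) (IsWeaklyRegular.nil R M)) (by simp [← hd])
    · have : localDepth R M ≤ d := by
        refine iSup₂_le fun rs hrs => ?_
        have := hcon rs hrs.1 hrs.2.1
        rw [← hd] at this
        norm_cast at this ⊢
        omega
      rw [h, ← hd] at this
      norm_cast at this
      omega
  · rintro ⟨rs, h1, h2, h3⟩
    apply le_antisymm
    · exact iSup₂_le fun rs hrs => hle hrs.1 hrs.2.1
    · exact h3.trans (le_iSup₂_of_le rs
        ⟨h1, IsRegular.of_isWeaklyRegular_of_mem_maximalIdeal M h1 h2⟩ le_rfl)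

end Depth

/-- Prime avoidance: the next element is taken in p outside the finitely many minimal primes of the
previous ideal of height at most n. A prime over the longer sequence contains a minimal prime that
either already has greater height or omits the new element, so that the inclusion is strict. -/
theorem exists_isHeightSequence {R : Type u} [CommRing R] [IsNoetherianRing R] (p : Ideal R)
    [p.IsPrime] (n : ℕ) (hn : (n : ℕ∞) ≤ p.height) :
    ∃ rs : List R, rs.length = n ∧ (∀ r ∈ rs, r ∈ p) ∧ IsHeightSequence rs := by
  induction n with
  | zero =>
    refine ⟨[], rfl, by simp, fun i hi q _ _ => ?_⟩
    obtain rfl : i = 0 := by simpa using hi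
    simp
  | succ n ih =>
    obtain ⟨rs, hlen, hmem, hrs⟩ := ih (le_trans (by norm_cast; omega) hn)
    have hnot : ¬ ((p : Set R) ⊆
        ⋃ q ∈ {q ∈ (Ideal.ofList rs).minimalPrimes | q.height ≤ n}, (q : Set R)) := by
      intro hsub
      have hfin : {q ∈ (Ideal.ofList rs).minimalPrimes | q.height ≤ n}.Finite :=
        (Ideal.finite_minimalPrimes_of_isNoetherianRing R _).subset fun q hq => hq.1
      obtain ⟨q, hq, hle⟩ := (Ideal.subset_union_prime_finite hfin (f := id) ⊥ ⊥
        (fun q hq _ _ => hq.1.1.1)).mp hsub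
      have := (hn.trans (Ideal.height_mono hle)).trans hq.2
      norm_cast at this
      omega
    obtain ⟨x, hxp, hx⟩ := Set.not_subset.mp hnot
    refine ⟨rs ++ [x], by simp [hlen], ?_, fun i hi q hq hle => ?_⟩
    · intro r hr
      rcases List.mem_append.mp hr with hr | hr
      · exact hmem r hr
      · rwa [List.mem_singleton.mp hr]
    · rcases hi.lt_or_eq with hi | rfl
      · rw [List.length_append, List.length_singleton, Nat.lt_succ_iff] at hi
        rw [List.take_append_of_le_length hi] at hle
        exact hrs i hi q hq hle
      · rw [List.take_length, Ideal.ofList_append, Ideal.ofList_singleton] at hle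
        obtain ⟨q', hq', hle'⟩ := Ideal.exists_minimalPrimes_le (le_sup_left.trans hle)
        have hq'p := hq'.1.1
        have h1 := hrs rs.length le_rfl q' hq'.1.1 (by rw [List.take_length]; exact hq'.1.2)
        rw [List.length_append, List.length_singleton, Nat.cast_add, Nat.cast_one]
        by_cases h : q'.height ≤ n
        · have hxq' : x ∉ q' := fun hxq' => hx (Set.mem_biUnion ⟨hq', h⟩ hxq')
          have hlt : q' < q := lt_of_le_of_ne hle' fun h => hxq' (h ▸
            (le_sup_right.trans hle) (Ideal.mem_span_singleton_self x))
          exact (add_le_add_left h1 _).trans (Ideal.height_add_one_le_of_lt_of_isPrime hlt)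
        · rw [hlen]
          exact (Order.add_one_le_of_lt (not_le.mp h)).trans (Ideal.height_mono hle')

/-! ### Regularity at a prime, without localizing -/

/-- A sequence of elements of `R` that is weakly regular on the localization of `M` at `p`. -/
def IsWeaklyRegularAt {R : Type u} [CommRing R] (p : Ideal R) (M : Type v) [AddCommGroup M]
    [Module R M] (rs : List R) : Prop :=
  ∀ i (h : i < rs.length) (m : M), rs[i] • m ∈ Ideal.ofList (rs.take i) • (⊤ : Submodule R M) →
    ∃ s ∉ p, s • m ∈ Ideal.ofList (rs.take i) • (⊤ : Submodule R M)

section Localization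

variable {R : Type u} [CommRing R] {p : Ideal R} {M : Type v} [AddCommGroup M] [Module R M]

theorem IsWeaklyRegularAt.mono {q : Ideal R} {rs : List R} (h : IsWeaklyRegularAt p M rs)
    (hqp : q ≤ p) : IsWeaklyRegularAt q M rs := fun i hi m hm =>
  let ⟨s, hs, hsm⟩ := h i hi m hm
  ⟨s, fun hsq => hs (hqp hsq), hsm⟩

/-- Multiplication by s is bijective on M', and it maps JM' onto itself, so it can be cancelled
modulo JM'. -/
theorem mem_ideal_smul_top_of_smul_mem_of_isLocalizedModule [p.IsPrime] {M' : Type*}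
    [AddCommGroup M'] [Module R M'] (f : M →ₗ[R] M') [IsLocalizedModule p.primeCompl f]
    {J : Ideal R} {s : R} (hs : s ∉ p) {y : M'} (hy : s • y ∈ J • (⊤ : Submodule R M')) :
    y ∈ J • (⊤ : Submodule R M') := by
  have hbij := (Module.End.isUnit_iff _).mp
    (IsLocalizedModule.map_units f (⟨s, hs⟩ : p.primeCompl))
  have key (y : M') (hy : y ∈ J • (⊤ : Submodule R M')) :
      ∃ z ∈ J • (⊤ : Submodule R M'), s • z = y := by
    induction hy using Submodule.smul_induction_on' with
    | smul r hr y _ =>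
      obtain ⟨z, hz⟩ := hbij.2 y
      refine ⟨r • z, Submodule.smul_mem_smul hr trivial, ?_⟩
      rw [smul_comm, ← hz]
      rfl
    | add x hx y hy ihx ihy =>
      obtain ⟨z, hz, rfl⟩ := ihx
      obtain ⟨z', hz', rfl⟩ := ihy
      exact ⟨z + z', add_mem hz hz', smul_add _ _ _⟩
  obtain ⟨z, hz, hzs⟩ := key _ hy
  obtain rfl : z = y := hbij.1 hzs
  exact hz

theorem mem_ideal_smul_top_iff_of_isLocalizedModule [p.IsPrime] {M' : Type*} [AddCommGroup M']
    [Module R M'] (f : M →ₗ[R] M') [IsLocalizedModule p.primeCompl f] (J : Ideal R) (m : M) :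
    f m ∈ J • (⊤ : Submodule R M') ↔ ∃ s ∉ p, s • m ∈ J • (⊤ : Submodule R M) := by
  have hmap (n : M) (hn : n ∈ J • (⊤ : Submodule R M)) : f n ∈ J • (⊤ : Submodule R M') := by
    have := Submodule.mem_map_of_mem (f := f) hn
    rw [Submodule.map_smul''] at this
    exact Submodule.smul_mono le_rfl le_top this
  constructor
  · intro h
    have key (y : M') (hy : y ∈ J • (⊤ : Submodule R M')) :
        ∃ s : p.primeCompl, ∃ n ∈ J • (⊤ : Submodule R M), (s : R) • y = f n := by
      induction hy using Submodule.smul_induction_on' with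
      | smul r hr y _ =>
        obtain ⟨⟨n, s⟩, hns⟩ := IsLocalizedModule.surj p.primeCompl f y
        refine ⟨s, r • n, Submodule.smul_mem_smul hr trivial, ?_⟩
        rw [smul_comm, map_smul]
        exact congrArg (r • ·) hns
      | add x hx y hy ihx ihy =>
        obtain ⟨s, n, hn, h⟩ := ihx
        obtain ⟨s', n', hn', h'⟩ := ihy
        refine ⟨s * s', (s' : R) • n + (s : R) • n',
          add_mem (Submodule.smul_mem _ _ hn) (Submodule.smul_mem _ _ hn'), ?_⟩
        rw [map_add, map_smul, map_smul, ← h, ← h', smul_add, Submonoid.coe_mul, mul_smul,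
          mul_smul, smul_comm (s : R) (s' : R) x]
    obtain ⟨s, n, hn, h⟩ := key _ h
    rw [← map_smul] at h
    obtain ⟨c, hc⟩ := (IsLocalizedModule.eq_iff_exists p.primeCompl f).mp h
    refine ⟨c * s, (c * s).2, ?_⟩
    rw [mul_smul]
    exact (congrArg (· ∈ J • (⊤ : Submodule R M)) hc).mpr (Submodule.smul_mem _ _ hn)
  · rintro ⟨s, hs, h⟩
    have h1 := hmap _ h
    rw [map_smul] at h1
    exact mem_ideal_smul_top_of_smul_mem_of_isLocalizedModule f hs h1

theorem isWeaklyRegularAt_iff_of_isLocalizedModule [p.IsPrime] {M' : Type*} [AddCommGroup M']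
    [Module R M'] (f : M →ₗ[R] M') [IsLocalizedModule p.primeCompl f] (rs : List R) :
    IsWeaklyRegularAt p M rs ↔ IsWeaklyRegular M' rs := by
  rw [isWeaklyRegular_iff]
  refine forall₂_congr fun i hi => ?_
  rw [isSMulRegular_iff_right_eq_zero_of_smul]
  constructor
  · intro h y hy
    obtain ⟨y, rfl⟩ := Submodule.Quotient.mk_surjective _ y
    rw [← Submodule.Quotient.mk_smul, Submodule.Quotient.mk_eq_zero] at hy
    rw [Submodule.Quotient.mk_eq_zero]
    obtain ⟨⟨m, s⟩, hms⟩ := IsLocalizedModule.surj p.primeCompl f y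
    have hms : (s : R) • y = f m := hms
    have h1 : f (rs[i] • m) ∈ Ideal.ofList (rs.take i) • (⊤ : Submodule R M') := by
      rw [map_smul, ← hms, smul_comm]
      exact Submodule.smul_mem _ _ hy
    obtain ⟨c, hc, hcm⟩ := (mem_ideal_smul_top_iff_of_isLocalizedModule (p := p) f _ _).mp h1
    rw [smul_comm] at hcm
    obtain ⟨d, hd, hdm⟩ := h (c • m) hcm
    refine mem_ideal_smul_top_of_smul_mem_of_isLocalizedModule (p := p) f s.2 ?_
    rw [hms, mem_ideal_smul_top_iff_of_isLocalizedModule (p := p) f]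
    exact ⟨d * c, (Ideal.IsPrime.mul_notMem ‹_› hd hc), by rwa [mul_smul]⟩
  · intro h m hm
    rw [← mem_ideal_smul_top_iff_of_isLocalizedModule (p := p) f]
    have := h (Submodule.Quotient.mk (f m)) (by
      rw [← Submodule.Quotient.mk_smul, Submodule.Quotient.mk_eq_zero, ← map_smul,
        mem_ideal_smul_top_iff_of_isLocalizedModule (p := p) f]
      exact ⟨1, p.one_notMem, by rwa [one_smul]⟩)
    rwa [Submodule.Quotient.mk_eq_zero] at this

/-- The third condition is the one to verify and the second the one to exploit. Contraction from the
localization preserves heights of primes, so height sequences in p remain height sequences after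
localizing. -/
theorem localDepth_eq_tfae {R : Type u} [CommRing R] [IsNoetherianRing R] (p : Ideal R)
    [p.IsPrime] {M M' : Type u} [AddCommGroup M] [Module R M] [AddCommGroup M'] [Module R M']
    [Module (Localization.AtPrime p) M'] [IsScalarTower R (Localization.AtPrime p) M']
    [Module.Finite (Localization.AtPrime p) M'] [Nontrivial M'] (f : M →ₗ[R] M')
    [IsLocalizedModule p.primeCompl f] :
    [(localDepth (Localization.AtPrime p) M' : WithBot ℕ∞) =
        ringKrullDim (Localization.AtPrime p),
      ∀ rs : List R, (∀ r ∈ rs, r ∈ p) → IsHeightSequence rs → IsWeaklyRegularAt p M rs,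
      ∃ rs : List R, (∀ r ∈ rs, r ∈ p) ∧ p.height ≤ rs.length ∧
        IsWeaklyRegularAt p M rs].TFAE := by
  have hnoeth : IsNoetherianRing (Localization.AtPrime p) :=
    IsLocalization.isNoetherianRing p.primeCompl _ ‹_›
  have hht : (maximalIdeal (Localization.AtPrime p)).height = p.height := by
    rw [← IsLocalization.height_under p.primeCompl, IsLocalization.AtPrime.under_maximalIdeal _ p]
  have hmap {rs : List R} (h : ∀ r ∈ rs, r ∈ p) :
      ∀ r ∈ rs.map (algebraMap R (Localization.AtPrime p)), r ∈ maximalIdeal _ := by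
    intro r hr
    obtain ⟨a, ha, rfl⟩ := List.mem_map.mp hr
    exact (IsLocalization.AtPrime.to_map_mem_maximal_iff _ p a).mpr (h a ha)
  tfae_have 1 → 2 := by
    intro h rs hmem hrs
    obtain ⟨ss, hss, hreg, hlen⟩ := localDepth_eq_iff.mp h
    rw [isWeaklyRegularAt_iff_of_isLocalizedModule f,
      ← isWeaklyRegular_map_algebraMap_iff (Localization.AtPrime p)]
    refine IsHeightSequence.isWeaklyRegular hss
      (IsRegular.of_isWeaklyRegular_of_mem_maximalIdeal M' hss hreg) hlen (hmap hmem) ?_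
    intro i hi q hq hle
    rw [List.length_map] at hi
    rw [← IsLocalization.height_under p.primeCompl]
    refine hrs i hi _ (hq.comap _) ?_
    rw [← List.map_take, ← Ideal.map_ofList] at hle
    exact Ideal.map_le_iff_le_comap.mp hle
  tfae_have 2 → 3 := by
    intro h
    obtain ⟨n, hn⟩ := ENat.ne_top_iff_exists.mp (Ideal.height_ne_top_of_isPrime (I := p))
    obtain ⟨rs, hlen, hmem, hrs⟩ := exists_isHeightSequence p n hn.le
    exact ⟨rs, hmem, by rw [hlen, hn], h rs hmem hrs⟩
  tfae_have 3 → 1 := by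
    rintro ⟨rs, hmem, hlen, hrs⟩
    refine localDepth_eq_iff.mpr ⟨_, hmap hmem, ?_, by rwa [hht, List.length_map]⟩
    rwa [isWeaklyRegular_map_algebraMap_iff, ← isWeaklyRegularAt_iff_of_isLocalizedModule (p := p) f]
  tfae_finish

end Localization

/-! ### Regular sequences on M[X] over R[X] -/

section Polynomial

open Polynomial

/-- The contraction of P is minimal over an ideal generated by as many elements as its height. Their
images together with t generate an ideal over which P is minimal, and Krull's height theorem
applies. -/
theorem height_le_height_comap_add_card {R S : Type*} [CommRing R] [CommRing S]
    [IsNoetherianRing R] [IsNoetherianRing S] (φ : R →+* S) (P : Ideal S) [P.IsPrime]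
    (t : Finset S) (ht : ∀ x ∈ t, x ∈ P)
    (hmin : ∀ Q : Ideal S, Q.IsPrime → (P.comap φ).map φ ≤ Q → (∀ x ∈ t, x ∈ Q) → Q ≤ P → P ≤ Q) :
    P.height ≤ (P.comap φ).height + t.card := by
  classical
  obtain ⟨s, hs, hcard⟩ := (P.comap φ).exists_finset_card_eq_height_of_isNoetherianRing
  have hP : P ∈ (Ideal.span ((s.image φ ∪ t : Finset S) : Set S)).minimalPrimes := by
    have hsP : ∀ x ∈ s, φ x ∈ P := fun x hx => hs.1.2 (Ideal.subset_span hx)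
    refine ⟨⟨inferInstance, Ideal.span_le.mpr fun x hx => ?_⟩, fun Q hQ hQP => ?_⟩
    · rcases Finset.mem_union.mp (Finset.mem_coe.mp hx) with hx | hx
      · obtain ⟨y, hy, rfl⟩ := Finset.mem_image.mp hx
        exact hsP y hy
      · exact ht x hx
    · have hQp := hQ.1
      refine hmin Q hQ.1 (Ideal.map_le_iff_le_comap.mpr (hs.2 ⟨hQp.comap φ, ?_⟩
        (Ideal.comap_mono hQP))) (fun x hx => hQ.2 (Ideal.subset_span ?_)) hQP
      · refine Ideal.span_le.mpr fun x hx => hQ.2 (Ideal.subset_span ?_)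
        exact Finset.mem_union_left _ (Finset.mem_image_of_mem φ hx)
      · exact Finset.mem_union_right _ hx
  refine (Ideal.height_le_card_of_mem_minimalPrimes_span_finset hP).trans ?_
  rw [← hcard]
  norm_cast
  exact (Finset.card_union_le _ _).trans (Nat.add_le_add_right Finset.card_image_le _)

/-- A prime `P` of `R[X]` that is not extended from `R` contains a polynomial `g` whose leading
coefficient is not in `P`, and it is the only prime containing `g` with the same contraction
to `R`. -/
theorem exists_leadingCoeff_notMem_of_map_comap_ne {R : Type u} [CommRing R] (P : Ideal R[X])
    [P.IsPrime] (hP : ¬ P ≤ (P.comap C).map C) :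
    ∃ g ∈ P, g.leadingCoeff ∉ P.comap C ∧
      ∀ Q : Ideal R[X], Q.IsPrime → (P.comap C).map C ≤ Q → g ∈ Q → Q ≤ P → P ≤ Q := by
  classical
  obtain ⟨f, hfP, hf⟩ := SetLike.not_le_iff_exists.mp hP
  have hex : ∃ n, ∃ g ∈ P, g ∉ (P.comap C).map C ∧ g.natDegree = n := ⟨_, f, hfP, hf, rfl⟩
  obtain ⟨g, hgP, hg, hgn⟩ := Nat.find_spec hex
  -- g has the least degree among the elements of P outside the extended ideal.
  have hmin (f : R[X]) (hfP : f ∈ P) (hf : f.natDegree < g.natDegree) :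
      f ∈ (P.comap C).map C := by
    by_contra h
    exact Nat.find_min hex (hgn ▸ hf) ⟨f, hfP, h, rfl⟩
  have hlc : g.leadingCoeff ∉ P.comap C := by
    intro h
    have h1 : C g.leadingCoeff * X ^ g.natDegree ∈ (P.comap C).map C :=
      Ideal.mul_mem_right _ _ (Ideal.mem_map_of_mem C h)
    have h2 : g.eraseLead ∉ (P.comap C).map C := fun h2 => hg (by
      rw [← eraseLead_add_C_mul_X_pow g]
      exact add_mem h2 h1)
    rcases eraseLead_natDegree_lt_or_eraseLead_eq_zero g with h3 | h3
    · refine h2 (hmin _ ?_ h3)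
      rw [← self_sub_C_mul_X_pow]
      exact sub_mem hgP (Ideal.map_comap_le h1)
    · exact h2 (h3 ▸ zero_mem _)
  have hpos : 0 < g.natDegree := by
    by_contra h
    have h0 : g.natDegree = 0 := by omega
    refine hlc ?_
    rw [leadingCoeff, h0, Ideal.mem_comap, ← eq_C_of_natDegree_eq_zero h0]
    exact hgP
  refine ⟨g, hgP, hlc, fun Q hQ hpQ hgQ hQP => ?_⟩
  have key (n : ℕ) : ∀ f ∈ P, f.natDegree = n → f ∈ Q := by
    induction n using Nat.strong_induction_on with
    | _ n ih =>
      intro f hf hfn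
      by_cases hlt : f.natDegree < g.natDegree
      · exact hpQ (hmin f hf hlt)
      -- Division by g: up to a multiple of g, the product of f with the leading coefficient of g
      -- has smaller degree. That coefficient is not in Q because Q ≤ P.
      · have h1 : g.cancelLeads f ∈ Q := ih _ (hfn ▸
          natDegree_cancelLeads_lt_of_natDegree_le_natDegree (not_lt.mp hlt) (by omega)) _
          (sub_mem (Ideal.mul_mem_left _ _ hf) (Ideal.mul_mem_left _ _ hgP)) rfl
        rw [cancelLeads, Nat.sub_eq_zero_of_le (not_lt.mp hlt), pow_zero, mul_one] at h1
        have h2 := (Submodule.sub_mem_iff_left Q (Ideal.mul_mem_left Q _ hgQ)).mp h1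
        exact (hQ.mem_or_mem h2).resolve_left fun h => hlc (hQP h)
  exact fun f hf => key _ f hf rfl

variable {R : Type u} [CommRing R] {M : Type v} [AddCommGroup M] [Module R M]

theorem PolynomialModule.mem_map_C_smul_top_iff {J : Ideal R} {f : PolynomialModule R M} :
    f ∈ J.map C • (⊤ : Submodule R[X] (PolynomialModule R M)) ↔
      ∀ n, f.coeff n ∈ J • (⊤ : Submodule R M) := by
  constructor
  · intro hf
    induction hf using Submodule.smul_induction_on' with
    | smul r hr g _ =>
      intro n
      rw [PolynomialModule.smul_apply]
      exact Submodule.sum_mem _ fun x _ =>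
        Submodule.smul_mem_smul (Ideal.mem_map_C_iff.mp hr _) trivial
    | add x _ y _ hx hy => exact fun n => add_mem (hx n) (hy n)
  · intro h
    have hsingle (n : ℕ) (m : M) (hm : m ∈ J • (⊤ : Submodule R M)) : PolynomialModule.single R n m ∈
        J.map C • (⊤ : Submodule R[X] (PolynomialModule R M)) := by
      induction hm using Submodule.smul_induction_on' with
      | smul r hr m _ =>
        rw [← zero_add n, ← PolynomialModule.monomial_smul_single]
        exact Submodule.smul_mem_smul (Ideal.mem_map_of_mem C hr) trivial
      | add x _ y _ hx hy => exact PolynomialModule.single_add (R := R) n x y ▸ add_mem hx hy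
    have hf : f = f.coeff.sum fun n m => PolynomialModule.single R n m := by
      apply PolynomialModule.coeff_injective
      rw [PolynomialModule.coeff_finsuppSum]
      exact (Finsupp.sum_single _).symm
    rw [hf]
    exact Submodule.sum_mem _ fun n _ => hsingle n _ (h n)

/-- Every prime `p` of `R` contains a sequence of length at least the height of `p` that is weakly
regular on `M` at `p`. -/
def HasRegularSequences (R : Type u) [CommRing R] (M : Type v) [AddCommGroup M] [Module R M] :
    Prop :=
  ∀ p : Ideal R, p.IsPrime → ∃ rs : List R, (∀ r ∈ rs, r ∈ p) ∧ p.height ≤ rs.length ∧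
    IsWeaklyRegularAt p M rs

theorem C_smul_coeff (r : R) (f : PolynomialModule R M) (n : ℕ) :
    ((C r : R[X]) • f).coeff n = r • f.coeff n := by
  rw [← monomial_zero_left, PolynomialModule.monomial_smul_apply]
  simp

theorem IsWeaklyRegularAt.map_C {P : Ideal R[X]} [P.IsPrime] {rs : List R}
    (h : IsWeaklyRegularAt (P.comap C) M rs) :
    IsWeaklyRegularAt P (PolynomialModule R M) (rs.map C) := by
  intro i hi f hf
  rw [List.length_map] at hi
  rw [← List.map_take, ← Ideal.map_ofList] at hf ⊢
  rw [List.getElem_map, PolynomialModule.mem_map_C_smul_top_iff] at hf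
  simp only [C_smul_coeff] at hf
  choose s hs hsf using fun n => h i hi (f.coeff n) (hf n)
  refine ⟨C (∏ n ∈ f.coeff.support, s n), ?_, ?_⟩
  · have : ∏ n ∈ f.coeff.support, s n ∈ (P.comap C).primeCompl := prod_mem fun n _ => hs n
    exact this
  · rw [PolynomialModule.mem_map_C_smul_top_iff]
    intro n
    rw [C_smul_coeff]
    by_cases hn : n ∈ f.coeff.support
    · rw [← Finset.prod_erase_mul _ _ hn, mul_smul]
      exact Submodule.smul_mem _ _ (hsf n)
    · rw [Finsupp.notMem_support_iff.mp hn, smul_zero]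
      exact zero_mem _

/-- The leading coefficient of `g` becomes invertible modulo the kernel of multiplication by `g`
on `(M ⧸ JM)[X]`. -/
theorem exists_leadingCoeff_pow_smul_mem {J : Ideal R} {g : R[X]} {f : PolynomialModule R M}
    (h : g • f ∈ J.map C • (⊤ : Submodule R[X] (PolynomialModule R M))) :
    ∃ k : ℕ, C (g.leadingCoeff ^ k) • f ∈
      J.map C • (⊤ : Submodule R[X] (PolynomialModule R M)) := by
  have key (d : ℕ) : ∀ f : PolynomialModule R M, (∀ n ≥ d, f.coeff n = 0) →
      g • f ∈ J.map C • (⊤ : Submodule R[X] (PolynomialModule R M)) →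
      ∃ k : ℕ, C (g.leadingCoeff ^ k) • f ∈
        J.map C • (⊤ : Submodule R[X] (PolynomialModule R M)) := by
    induction d with
    | zero =>
      intro f hf _
      refine ⟨0, ?_⟩
      rw [show f = 0 from PolynomialModule.coeff_injective (Finsupp.ext fun n => hf n n.zero_le),
        smul_zero]
      exact zero_mem _
    | succ d ih =>
      intro f hf hgf
      -- This is the coefficient of g f in the top possible degree. Multiplying f by the leading
      -- coefficient of g and removing this term, which is zero modulo J, lowers the degree; hence
      -- the exponent k + 1 below.
      have h1 : g.leadingCoeff • f.coeff d ∈ J • (⊤ : Submodule R M) := by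
        have := PolynomialModule.mem_map_C_smul_top_iff.mp hgf (g.natDegree + d)
        rw [PolynomialModule.smul_apply, Finset.sum_eq_single (g.natDegree, d)] at this
        · exact this
        · rintro ⟨a, b⟩ hab hne
          rw [Finset.HasAntidiagonal.mem_antidiagonal] at hab
          by_cases ha : g.natDegree < a
          · rw [coeff_eq_zero_of_natDegree_lt ha, zero_smul]
          · rw [hf b (by
              by_contra hb
              exact hne (Prod.ext (by dsimp at hab ⊢; omega) (by dsimp at hab ⊢; omega))),
              smul_zero]
        · exact fun h => absurd (by rw [Finset.HasAntidiagonal.mem_antidiagonal]) h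
      have h2 : PolynomialModule.single R d (g.leadingCoeff • f.coeff d) ∈
          J.map C • (⊤ : Submodule R[X] (PolynomialModule R M)) := by
        rw [PolynomialModule.mem_map_C_smul_top_iff]
        intro n
        rw [PolynomialModule.coeff_single, Finsupp.single_apply]
        split_ifs
        · exact h1
        · exact zero_mem _
      obtain ⟨k, hk⟩ := ih
        (C g.leadingCoeff • f - PolynomialModule.single R d (g.leadingCoeff • f.coeff d))
        (fun n hn => by
          have hsub : (C g.leadingCoeff • f -
              PolynomialModule.single R d (g.leadingCoeff • f.coeff d)).coeff n =
              (C g.leadingCoeff • f).coeff n -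
              (PolynomialModule.single R d (g.leadingCoeff • f.coeff d)).coeff n := rfl
          rw [hsub, C_smul_coeff, PolynomialModule.coeff_single, Finsupp.single_apply]
          split_ifs with hdn
          · rw [hdn, sub_self]
          · rw [hf n (by omega), smul_zero, sub_zero])
        (by
          rw [smul_sub, smul_comm]
          exact sub_mem (Submodule.smul_mem _ _ hgf) (Submodule.smul_mem _ _ h2))
      refine ⟨k + 1, ?_⟩
      rw [smul_sub] at hk
      rw [pow_succ, C_mul, mul_smul]
      exact (Submodule.sub_mem_iff_left _ (Submodule.smul_mem _ _ h2)).mp hk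
  refine key (f.coeff.support.sup id + 1) f (fun n hn => ?_) h
  rw [← Finsupp.notMem_support_iff]
  intro hn'
  have := Finset.le_sup (f := id) hn'
  dsimp at this
  omega

/-- Let p be the contraction of P. If P is extended from p, its height is at most that of p and the
sequence for p suffices. Otherwise the height grows by at most one, and a polynomial g in P with
leading coefficient outside p supplies one more regular element, since that coefficient is
invertible at P. -/
theorem HasRegularSequences.polynomialModule [IsNoetherianRing R] (h : HasRegularSequences R M) :
    HasRegularSequences R[X] (PolynomialModule R M) := by
  intro P hP
  obtain ⟨rs, hmem, hlen, hrs⟩ := h (P.comap C) (hP.comap C)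
  have hmem' : ∀ r ∈ rs.map C, r ∈ P := by
    intro r hr
    obtain ⟨a, ha, rfl⟩ := List.mem_map.mp hr
    exact hmem a ha
  by_cases hle : P ≤ (P.comap C).map C
  · refine ⟨rs.map C, hmem', ?_, hrs.map_C⟩
    rw [List.length_map]
    have := height_le_height_comap_add_card C P ∅ (by simp) (fun Q _ hQ _ _ => hle.trans hQ)
    simpa using this.trans (add_le_add_left hlen _)
  · obtain ⟨g, hgP, hg, hmin⟩ := exists_leadingCoeff_notMem_of_map_comap_ne P hle
    refine ⟨rs.map C ++ [g], ?_, ?_, ?_⟩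
    · intro r hr
      rcases List.mem_append.mp hr with hr | hr
      · exact hmem' r hr
      · rwa [List.mem_singleton.mp hr]
    · have := height_le_height_comap_add_card C P {g} (by simpa using hgP)
        (fun Q hQ h1 h2 h3 => hmin Q hQ h1 (h2 g (by simp)) h3)
      rw [List.length_append, List.length_map]
      simpa using this.trans (add_le_add_left hlen _)
    · intro i hi f hf
      rcases (Nat.lt_succ_iff.mp (by simpa using hi)).lt_or_eq with hi' | rfl
      · have hi'' : i < (rs.map C).length := by simpa using hi'
        rw [List.take_append_of_le_length hi''.le] at hf ⊢
        rw [List.getElem_append_left hi''] at hf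
        exact hrs.map_C i hi'' f hf
      · have hlen' : rs.length = (rs.map C).length := (List.length_map _).symm
        rw [List.take_append_of_le_length hlen'.le, List.take_of_length_le hlen'.ge,
          ← Ideal.map_ofList] at hf ⊢
        rw [List.getElem_append_right hlen'.ge] at hf
        simp only [List.getElem_singleton] at hf
        obtain ⟨k, hk⟩ := exists_leadingCoeff_pow_smul_mem hf
        exact ⟨_, fun hmem => hg ((hP.comap C).mem_of_pow_mem k hmem), hk⟩

end Polynomial

/-! ### Duals and reflexive hulls through divisibility -/

section SameDual

variable {A : Type u} [CommRing A]

/-- Two ideals with the same dual inside the fraction field. -/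
def SameDual (I J : Ideal A) : Prop :=
  ∀ a b : A, b ≠ 0 → ((∀ i ∈ I, b ∣ a * i) ↔ ∀ j ∈ J, b ∣ a * j)

theorem forall_mem_mul_dvd_iff {I J : Ideal A} {a b : A} :
    (∀ x ∈ I * J, b ∣ a * x) ↔ ∀ j ∈ J, ∀ i ∈ I, b ∣ a * j * i := by
  constructor
  · intro h j hj i hi
    rw [mul_assoc, mul_comm j]
    exact h _ (Ideal.mul_mem_mul hi hj)
  · intro h x hx
    induction hx using Submodule.mul_induction_on' with
    | mem_mul_mem i hi j hj =>
      rw [mul_comm i, ← mul_assoc]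
      exact h j hj i hi
    | add x _ y _ hx hy =>
      rw [mul_add]
      exact dvd_add hx hy

namespace SameDual

variable {I I' J J' : Ideal A}

theorem refl (I : Ideal A) : SameDual I I := fun _ _ _ => Iff.rfl

/-- (A : IJ) = ((A : I) : J), so the dual of a product depends on I only through the dual of I. -/
theorem mul_right (h : SameDual I I') (J : Ideal A) : SameDual (I * J) (I' * J) := by
  intro a b hb
  rw [forall_mem_mul_dvd_iff, forall_mem_mul_dvd_iff]
  exact forall₂_congr fun j _ => h _ _ hb

theorem mul (h : SameDual I I') (h' : SameDual J J') : SameDual (I * J) (I' * J') := by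
  intro a b hb
  rw [h.mul_right J a b hb, mul_comm I', mul_comm I', h'.mul_right I' a b hb]

theorem pow (h : SameDual I I') (n : ℕ) : SameDual (I ^ n) (I' ^ n) := by
  induction n with
  | zero => rw [pow_zero, pow_zero]; exact refl _
  | succ n ih => rw [pow_succ, pow_succ]; exact ih.mul h

theorem prod {ι : Type*} (s : Finset ι) {I I' : ι → Ideal A} (h : ∀ i, SameDual (I i) (I' i)) :
    SameDual (∏ i ∈ s, I i) (∏ i ∈ s, I' i) := by
  classical
  induction s using Finset.induction_on with
  | empty => exact refl _
  | insert i s hi ih => rw [Finset.prod_insert hi, Finset.prod_insert hi]; exact (h i).mul ih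

end SameDual

end SameDual

section HullDomain

variable {A : Type u} [CommRing A] [IsDomain A]

/-- The reflexive hull of a nonzero ideal of a domain in terms of divisibility. -/
theorem mem_reflexiveHull_iff {I : Ideal A} (hI : I ≠ ⊥) {x : A} :
    x ∈ reflexiveHull I ↔ ∀ a b : A, b ≠ 0 → (∀ i ∈ I, b ∣ a * i) → b ∣ a * x := by
  obtain ⟨i₀, hi₀, h0⟩ := (Submodule.ne_bot_iff I).mp hI
  -- Every functional on I is multiplication by the fraction f(i₀)/i₀. So the element of the double
  -- dual attached to x must send f to f(i₀)x/i₀.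
  have hcomm (f : Module.Dual A I) (i : A) (hi : i ∈ I) : f ⟨i₀, hi₀⟩ * i = i₀ * f ⟨i, hi⟩ := by
    rw [mul_comm, ← smul_eq_mul, ← smul_eq_mul, ← map_smul, ← map_smul]
    congr 1
    exact Subtype.ext (mul_comm _ _)
  constructor
  · rintro ⟨φ, rfl⟩ a b hb h
    choose! q hq using h
    let f : Module.Dual A I :=
      { toFun := fun i => q i
        map_add' := fun i j => mul_left_cancel₀ hb (by
          rw [mul_add, ← hq _ i.2, ← hq _ j.2, ← hq _ (i + j).2, Submodule.coe_add, mul_add])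
        map_smul' := fun c i => mul_left_cancel₀ hb (by
          rw [RingHom.id_apply, smul_eq_mul, mul_left_comm, ← hq _ i.2, ← hq _ (c • i).2,
            Submodule.coe_smul, smul_eq_mul, mul_left_comm]) }
    have hf : b • f = a • I.subtype := LinearMap.ext fun i => (hq i i.2).symm
    refine ⟨φ f, ?_⟩
    change a * φ I.subtype = b * φ f
    rw [← smul_eq_mul, ← smul_eq_mul, ← map_smul, ← map_smul, hf]
  · intro h
    have hdvd (f : Module.Dual A I) : ∃ y, f ⟨i₀, hi₀⟩ * x = i₀ * y :=
      h _ _ h0 fun i hi => ⟨_, hcomm f i hi⟩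
    choose g hg using hdvd
    refine ⟨{ toFun := g
              map_add' := fun f f' => mul_left_cancel₀ h0 ?_
              map_smul' := fun c f => mul_left_cancel₀ h0 ?_ }, mul_left_cancel₀ h0 ?_⟩
    · rw [mul_add, ← hg, ← hg, ← hg, LinearMap.add_apply, add_mul]
    · rw [RingHom.id_apply, smul_eq_mul, mul_left_comm, ← hg, ← hg, LinearMap.smul_apply,
        smul_eq_mul, mul_assoc]
    · exact (hg I.subtype).symm

theorem SameDual.reflexiveHull_eq {I J : Ideal A} (h : SameDual I J) (hI : I ≠ ⊥)
    (hJ : J ≠ ⊥) : reflexiveHull I = reflexiveHull J := by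
  ext x
  rw [mem_reflexiveHull_iff hI, mem_reflexiveHull_iff hJ]
  exact forall₃_congr fun a b hb => imp_congr (h a b hb) Iff.rfl

theorem mem_reflexiveHull_span_singleton_mul_iff {f : A} (hf : f ≠ 0) {J : Ideal A} (hJ : J ≠ ⊥)
    {x : A} : x ∈ reflexiveHull (Ideal.span {f} * J) ↔ ∃ y ∈ reflexiveHull J, f * y = x := by
  have hfJ : Ideal.span {f} * J ≠ ⊥ :=
    mul_ne_zero (by simpa [Ideal.zero_eq_bot] using hf) hJ
  rw [mem_reflexiveHull_iff hfJ]
  have hmem (a b : A) : (∀ i ∈ Ideal.span {f} * J, b ∣ a * i) ↔ ∀ j ∈ J, b ∣ a * (f * j) := by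
    simp only [Ideal.mem_span_singleton_mul]
    exact ⟨fun h j hj => h _ ⟨j, hj, rfl⟩, by rintro h _ ⟨j, hj, rfl⟩; exact h j hj⟩
  simp only [hmem]
  constructor
  · intro h
    -- The fraction 1/f carries fJ into A, so f divides x.
    obtain ⟨y, hy⟩ := h 1 f hf fun j _ => by rw [one_mul]; exact dvd_mul_right f j
    rw [one_mul] at hy
    refine ⟨y, (mem_reflexiveHull_iff hJ).mpr fun a b hb hab => ?_, hy.symm⟩
    have := h a (f * b) (mul_ne_zero hf hb) fun j hj => by
      rw [mul_left_comm]; exact mul_dvd_mul_left f (hab j hj)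
    rw [hy, mul_left_comm] at this
    exact (mul_dvd_mul_iff_left hf).mp this
  · rintro ⟨y, hy, rfl⟩ a b hb hab
    rw [← mul_assoc]
    exact (mem_reflexiveHull_iff hJ).mp hy _ _ hb fun j hj => by rw [mul_assoc]; exact hab j hj

variable [IsNoetherianRing A] [IsIntegrallyClosed A]

/-- If the class of `I` has finite order, a power of `I` has the same dual as a principal ideal. -/
theorem exists_pow_sameDual_span_singleton {I : Ideal A} (hI : I ≠ ⊥)
    (hfin : IsOfFinOrder (divisorClass I hI)) :
    ∃ r > 0, ∃ f : A, f ≠ 0 ∧ SameDual (I ^ r) (Ideal.span {f}) := by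
  obtain ⟨r, hr, hpow⟩ := isOfFinOrder_iff_pow_eq_one.mp hfin
  refine ⟨r, hr, ?_⟩
  rw [divisorClass, ← QuotientGroup.mk_pow, QuotientGroup.eq_one_iff] at hpow
  obtain ⟨x, hx⟩ := hpow
  rw [← map_pow] at hx
  have hx : (1 : FractionalIdeal A⁰ (FractionRing A)) /
      FractionalIdeal.spanSingleton A⁰ (x : FractionRing A) =
      1 / ((I : FractionalIdeal A⁰ (FractionRing A)) ^ r) := (divisorCon A).eq.mp hx
  rw [← FractionalIdeal.coeIdeal_pow] at hx
  have hIr : ((I ^ r : Ideal A) : FractionalIdeal A⁰ (FractionRing A)) ≠ 0 :=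
    FractionalIdeal.coeIdeal_ne_zero.mpr (pow_ne_zero r hI)
  have hs : FractionalIdeal.spanSingleton A⁰ (x : FractionRing A) ≠ 0 :=
    FractionalIdeal.spanSingleton_ne_zero_iff.mpr x.ne_zero
  have key (y : FractionRing A) : (∀ i ∈ I ^ r, y * algebraMap A (FractionRing A) i ∈
      (1 : FractionalIdeal A⁰ (FractionRing A))) ↔
      y * x ∈ (1 : FractionalIdeal A⁰ (FractionRing A)) := by
    have h1 := mem_one_div_iff A hIr (x := y)
    have h2 := mem_one_div_iff A hs (x := y)
    rw [hx, h1] at h2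
    constructor
    · intro h
      exact h2.mp (fun z hz => by
        obtain ⟨i, hi, rfl⟩ := (FractionalIdeal.mem_coeIdeal _).mp hz
        exact h i hi) _ (FractionalIdeal.mem_spanSingleton_self _ _)
    · intro h i hi
      refine h2.mpr (fun z hz => ?_) _ (FractionalIdeal.mem_coeIdeal_of_mem _ hi)
      obtain ⟨c, rfl⟩ := (FractionalIdeal.mem_spanSingleton _).mp hz
      rw [mul_smul_comm]
      exact Submodule.smul_mem _ c h
  -- The generator x lies a priori only in the fraction field. Since 1 carries I^r into A, it also
  -- carries x into A.
  have hone := (key 1).mp fun i _ => by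
    rw [one_mul]; exact FractionalIdeal.coe_mem_one _ _
  rw [one_mul] at hone
  obtain ⟨f, hf⟩ := (FractionalIdeal.mem_one_iff _).mp hone
  refine ⟨f, fun h0 => x.ne_zero (by rw [← hf, h0, map_zero]), fun a b hb => ?_⟩
  have hdvd (i : A) : b ∣ a * i ↔ algebraMap A (FractionRing A) a / algebraMap A _ b *
      algebraMap A _ i ∈ (1 : FractionalIdeal A⁰ (FractionRing A)) := by
    have hb' : algebraMap A (FractionRing A) b ≠ 0 := by simpa using hb
    rw [FractionalIdeal.mem_one_iff]
    refine exists_congr fun c => ?_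
    rw [div_mul_eq_mul_div, eq_div_iff hb', ← map_mul, ← map_mul,
      (IsFractionRing.injective A (FractionRing A)).eq_iff, mul_comm c, eq_comm]
  simp only [hdvd]
  rw [key, ← hf]
  constructor
  · intro h j hj
    obtain ⟨c, rfl⟩ := Ideal.mem_span_singleton'.mp hj
    rw [map_mul, mul_left_comm, ← Algebra.smul_def]
    exact Submodule.smul_mem _ c h
  · exact fun h => h f (Ideal.mem_span_singleton_self f)

/-- A common exponent for finitely many ideals whose classes have finite order. -/
theorem exists_common_pow_sameDual {k : ℕ} (I : Fin k → Ideal A) (hI : ∀ i, I i ≠ ⊥)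
    (hfin : ∀ i, IsOfFinOrder (divisorClass (I i) (hI i))) :
    ∃ r > 0, ∃ f : Fin k → A, (∀ i, f i ≠ 0) ∧
      ∀ i, SameDual (I i ^ r) (Ideal.span {f i}) := by
  choose r hr f hf hs using fun i => exists_pow_sameDual_span_singleton (hI i) (hfin i)
  refine ⟨∏ i, r i, Finset.prod_pos fun i _ => hr i,
    fun i => f i ^ ∏ j ∈ Finset.univ.erase i, r j, fun i => pow_ne_zero _ (hf i), fun i => ?_⟩
  rw [← Finset.mul_prod_erase _ _ (Finset.mem_univ i), pow_mul, ← Ideal.span_singleton_pow]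
  exact (hs i).pow _

end HullDomain

/-! ### Transfer of regular sequences along sums and retracts -/

section Modules

variable {R : Type u} [CommRing R]

theorem map_mem_smul_top {M N : Type*} [AddCommGroup M] [Module R M] [AddCommGroup N] [Module R N]
    (g : M →ₗ[R] N) {J : Ideal R} {m : M} (hm : m ∈ J • (⊤ : Submodule R M)) :
    g m ∈ J • (⊤ : Submodule R N) := by
  have := Submodule.mem_map_of_mem (f := g) hm
  rw [Submodule.map_smul''] at this
  exact Submodule.smul_mono le_rfl le_top this

/-- Each element involves only finitely many components, so the product of their multipliers is
still outside the prime p. -/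
theorem IsWeaklyRegularAt.of_sum {p : Ideal R} [p.IsPrime] {M : Type*} [AddCommGroup M] [Module R M]
    {ι : Type*} {N : ι → Type*} [∀ n, AddCommGroup (N n)] [∀ n, Module R (N n)]
    (π : ∀ n, M →ₗ[R] N n) (σ : ∀ n, N n →ₗ[R] M)
    (hsum : ∀ m, ∃ F : Finset ι, m = ∑ n ∈ F, σ n (π n m)) {rs : List R}
    (h : ∀ n, IsWeaklyRegularAt p (N n) rs) : IsWeaklyRegularAt p M rs := by
  classical
  intro i hi m hm
  choose s hs hsm using fun n => h n i hi (π n m) (by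
    rw [← map_smul]; exact map_mem_smul_top (π n) hm)
  obtain ⟨F, hF⟩ := hsum m
  refine ⟨∏ n ∈ F, s n, ?_, ?_⟩
  · have : ∏ n ∈ F, s n ∈ p.primeCompl := prod_mem fun n _ => hs n
    exact this
  · rw [hF, Finset.smul_sum]
    refine Submodule.sum_mem _ fun n hn => ?_
    rw [← Finset.prod_erase_mul _ _ hn, mul_smul, ← map_smul]
    exact Submodule.smul_mem _ _ (map_mem_smul_top (σ n) (hsm n))

theorem IsWeaklyRegularAt.of_retract {p : Ideal R} {M N : Type*} [AddCommGroup M] [Module R M]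
    [AddCommGroup N] [Module R N] (σ : N →ₗ[R] M) (π : M →ₗ[R] N) (h : ∀ x, π (σ x) = x)
    {rs : List R} (hrs : IsWeaklyRegularAt p M rs) : IsWeaklyRegularAt p N rs := by
  intro i hi x hx
  obtain ⟨s, hs, hsx⟩ := hrs i hi (σ x) (by rw [← map_smul]; exact map_mem_smul_top σ hx)
  refine ⟨s, hs, ?_⟩
  have := map_mem_smul_top π hsx
  rwa [map_smul, h] at this

open Polynomial in
theorem finite_polynomialModule (M : Type*) [AddCommGroup M] [Module R M] [Module.Finite R M] :
    Module.Finite R[X] (PolynomialModule R M) := by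
  obtain ⟨s, hs⟩ := Module.Finite.fg_top (R := R) (M := M)
  classical
  refine ⟨⟨s.image (PolynomialModule.single R 0), top_le_iff.mp fun x _ => ?_⟩⟩
  have hsingle (m : M) : PolynomialModule.single R 0 m ∈ Submodule.span R[X]
      ((s.image (PolynomialModule.single R 0) : Finset _) : Set (PolynomialModule R M)) := by
    have hm : m ∈ Submodule.span R (s : Set M) := hs ▸ trivial
    induction hm using Submodule.span_induction with
    | mem m hm => exact Submodule.subset_span (Finset.mem_coe.mpr (Finset.mem_image_of_mem _ hm))
    | zero => rw [PolynomialModule.single_zero]; exact zero_mem _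
    | add m n _ _ hm hn => rw [PolynomialModule.single_add]; exact add_mem hm hn
    | smul r m _ hm =>
      have := Submodule.smul_mem _ (monomial 0 r) hm
      rwa [PolynomialModule.monomial_smul_single, zero_add] at this
  induction x using PolynomialModule.induction_linear with
  | zero => exact zero_mem _
  | add x y hx hy => exact add_mem (hx trivial) (hy trivial)
  | single n m =>
    have := Submodule.smul_mem _ (monomial n (1 : R)) (hsingle m)
    rwa [PolynomialModule.monomial_smul_single, add_zero, one_smul] at this

end Modules

/-! ### Graded components of the Rees algebra and their periodicity -/

section Structure

open MvPolynomial

variable {A : Type u} [CommRing A] {k : ℕ} (I : Fin k → Ideal A)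

/-- The coefficient ideal of `U^n` in the multi-symbolic Rees algebra. -/
abbrev coeffIdeal (n : Fin k →₀ ℕ) : Ideal A := reflexiveHull (∏ i, I i ^ n i)

/-- The coefficient at `U^n`. -/
def coeffMap (n : Fin k →₀ ℕ) : multiSymbolicRees I →ₗ[A] coeffIdeal I n where
  toFun b := ⟨coeff n (b : MvPolynomial (Fin k) A), b.2 n⟩
  map_add' _ _ := Subtype.ext (coeff_add _ _ _)
  map_smul' _ _ := Subtype.ext (coeff_smul _ _ _)

/-- The homogeneous element with coefficient `c` at `U^n`. -/
noncomputable def monomialMap (n : Fin k →₀ ℕ) : coeffIdeal I n →ₗ[A] multiSymbolicRees I where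
  toFun c := ⟨monomial n (c : A), fun m => by
    classical
    rw [coeff_monomial]
    split_ifs with h
    · exact h ▸ c.2
    · exact zero_mem _⟩
  map_add' _ _ := Subtype.ext (map_add _ _ _)
  map_smul' _ _ := Subtype.ext (map_smul _ _ _)

variable {I}

theorem coe_monomialMap (n : Fin k →₀ ℕ) (c : coeffIdeal I n) :
    (monomialMap I n c : MvPolynomial (Fin k) A) = monomial n (c : A) := rfl

theorem coe_coeffMap (n : Fin k →₀ ℕ) (b : multiSymbolicRees I) :
    (coeffMap I n b : A) = coeff n (b : MvPolynomial (Fin k) A) := rfl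

theorem coeffMap_monomialMap (n : Fin k →₀ ℕ) (c : coeffIdeal I n) :
    coeffMap I n (monomialMap I n c) = c := Subtype.ext (by
  classical
  rw [coe_coeffMap, coe_monomialMap, coeff_monomial, if_pos rfl])

theorem sum_monomialMap_coeffMap (b : multiSymbolicRees I) :
    ∑ n ∈ (b : MvPolynomial (Fin k) A).support, monomialMap I n (coeffMap I n b) = b := by
  apply Subtype.ext
  rw [AddSubmonoidClass.coe_finsetSum]
  exact support_sum_monomial_coeff _

/-- The elements of the multi-symbolic Rees algebra in which the variables from the `i`-th on
occur with exponents less than `r`. -/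
def boundedPart (I : Fin k → Ideal A) (r i : ℕ) : Submodule A (multiSymbolicRees I) where
  carrier := {b | ∀ n, ∀ j : Fin k, i ≤ j → r ≤ n j → coeff n (b : MvPolynomial (Fin k) A) = 0}
  add_mem' ha hb n j hj hn := by
    rw [AddMemClass.coe_add, coeff_add, ha n j hj hn, hb n j hj hn, add_zero]
  zero_mem' _ _ _ _ := coeff_zero _
  smul_mem' c b hb n j hj hn := by
    change coeff n (c • (b : MvPolynomial (Fin k) A)) = 0
    rw [coeff_smul, hb n j hj hn, smul_zero]

theorem monomialMap_mem_boundedPart {r i : ℕ} {n : Fin k →₀ ℕ}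
    (hn : ∀ j : Fin k, i ≤ j → n j < r) (c : coeffIdeal I n) :
    monomialMap I n c ∈ boundedPart I r i := by
  classical
  intro m j hj hm
  rw [coe_monomialMap, coeff_monomial, if_neg]
  rintro rfl
  exact absurd (hn j hj) (not_lt.mpr hm)

theorem lt_of_mem_support_of_mem_boundedPart {r i : ℕ} {b : multiSymbolicRees I}
    (hb : b ∈ boundedPart I r i) {n : Fin k →₀ ℕ}
    (hn : n ∈ (b : MvPolynomial (Fin k) A).support) (j : Fin k) (hj : i ≤ j) : n j < r := by
  by_contra h
  exact mem_support_iff.mp hn (hb n j hj (not_lt.mp h))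

theorem finite_boundedPart_zero [IsNoetherianRing A] (r : ℕ) :
    Module.Finite A (boundedPart I r 0) := by
  let g : boundedPart I r 0 →ₗ[A] ((Fin k → Fin r) → A) :=
    { toFun := fun b β => coeff (Finsupp.equivFunOnFinite.symm fun j => (β j : ℕ))
        ((b : multiSymbolicRees I) : MvPolynomial (Fin k) A)
      map_add' := fun _ _ => funext fun _ => coeff_add _ _ _
      map_smul' := fun _ _ => funext fun _ => coeff_smul _ _ _ }
  refine Module.Finite.of_injective g fun b b' hb => ?_
  refine Subtype.ext (Subtype.ext (MvPolynomial.ext _ _ fun n => ?_))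
  by_cases h : ∀ j, n j < r
  · have := congrFun hb fun j => ⟨n j, h j⟩
    have hn : (Finsupp.equivFunOnFinite.symm fun j => n j) = n := by ext; simp
    change coeff (Finsupp.equivFunOnFinite.symm fun j => n j) _ =
      coeff (Finsupp.equivFunOnFinite.symm fun j => n j) _ at this
    rwa [hn] at this
  · push Not at h
    obtain ⟨j, hj⟩ := h
    exact (b.2 n j (Nat.zero_le _) hj).trans (b'.2 n j (Nat.zero_le _) hj).symm

theorem isWeaklyRegularAt_boundedPart_zero {p : Ideal A} [p.IsPrime] {rs : List A} (r : ℕ)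
    (h : ∀ n, IsWeaklyRegularAt p (coeffIdeal I n) rs) :
    IsWeaklyRegularAt p (boundedPart I r 0) rs := by
  classical
  refine IsWeaklyRegularAt.of_sum (ι := {n : Fin k →₀ ℕ // ∀ j, n j < r})
    (N := fun n => coeffIdeal I n) (fun n => (coeffMap I n).comp (boundedPart I r 0).subtype)
    (fun n => (monomialMap I n).codRestrict _ fun c =>
      monomialMap_mem_boundedPart (fun j _ => n.2 j) c) (fun b => ?_) fun n => h n
  refine ⟨(b : MvPolynomial (Fin k) A).support.subtype _, Subtype.ext ?_⟩
  rw [AddSubmonoidClass.coe_finsetSum]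
  refine (sum_monomialMap_coeffMap (b : multiSymbolicRees I)).symm.trans ?_
  refine (Finset.sum_subtype_of_mem
    (fun n => monomialMap I n (coeffMap I n (b : multiSymbolicRees I))) fun n hn => ?_).symm
  exact fun j => lt_of_mem_support_of_mem_boundedPart b.2 hn j (Nat.zero_le _)

theorem mem_coeffIdeal_zero (x : A) : x ∈ coeffIdeal I 0 :=
  le_reflexiveHull _ (by simp [-Ideal.one_eq_top])

end Structure

section Domain

open MvPolynomial

variable {A : Type u} [CommRing A] [IsDomain A] {k : ℕ} {I : Fin k → Ideal A} {r : ℕ}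
  {f : Fin k → A}

/-- Periodicity of the components: the ideal product in degree r e + n has the same dual as f^e
times the one in degree n, and a principal factor comes out of a reflexive hull. -/
theorem mem_coeffIdeal_add_mul_iff (hI : ∀ i, I i ≠ ⊥) (hf : ∀ i, f i ≠ 0)
    (hs : ∀ i, SameDual (I i ^ r) (Ideal.span {f i})) (n e : Fin k →₀ ℕ) {x : A} :
    x ∈ coeffIdeal I (r • e + n) ↔ ∃ y ∈ coeffIdeal I n, (∏ i, f i ^ e i) * y = x := by
  have hne (n : Fin k →₀ ℕ) : ∏ i, I i ^ n i ≠ ⊥ :=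
    Finset.prod_ne_zero_iff.mpr fun i _ => pow_ne_zero _ (hI i)
  have hfe : ∏ i, f i ^ e i ≠ 0 := Finset.prod_ne_zero_iff.mpr fun i _ => pow_ne_zero _ (hf i)
  have h1 : SameDual (∏ i, I i ^ (r • e + n) i)
      (Ideal.span {∏ i, f i ^ e i} * ∏ i, I i ^ n i) := by
    simp only [Finsupp.add_apply, Finsupp.smul_apply, smul_eq_mul, pow_add, pow_mul,
      Finset.prod_mul_distrib, ← Ideal.prod_span_singleton, ← Ideal.span_singleton_pow]
    exact (SameDual.prod _ fun i => (hs i).pow _).mul_right _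
  rw [coeffIdeal, h1.reflexiveHull_eq (hne _)
    (mul_ne_zero (by simpa [Ideal.zero_eq_bot] using hfe) (hne n)),
    mem_reflexiveHull_span_singleton_mul_iff hfe (hne n)]

theorem prod_pow_single {A : Type*} [CommMonoid A] {k : ℕ} (f : Fin k → A) (j : Fin k) (q : ℕ) :
    ∏ i, f i ^ Finsupp.single j q i = f j ^ q := by
  rw [Finset.prod_eq_single j (fun i _ hij => by
    rw [Finsupp.single_eq_of_ne hij, pow_zero]) (by simp), Finsupp.single_eq_same]

theorem mem_coeffIdeal_single (hI : ∀ i, I i ≠ ⊥) (hf : ∀ i, f i ≠ 0)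
    (hs : ∀ i, SameDual (I i ^ r) (Ideal.span {f i})) (j : Fin k) :
    f j ∈ coeffIdeal I (r • Finsupp.single j 1) := by
  rw [← add_zero (r • _), mem_coeffIdeal_add_mul_iff hI hf hs]
  exact ⟨1, mem_coeffIdeal_zero 1, by rw [prod_pow_single, pow_one, mul_one]⟩

end Domain

/-! ### Adjoining a variable and passing to a finite extension -/

section Descent

variable {B : Type u} [CommRing B]

/-- The subgroup `N` of `B` is a finite module with regular sequences over a Noetherian ring that
acts through a homomorphism to `B`. -/
def IsFiniteRegularOver (N : AddSubgroup B) : Prop :=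
  ∃ (R : Type u) (_ : CommRing R) (_ : IsNoetherianRing R) (M : Type u) (_ : AddCommGroup M)
    (_ : Module R M) (_ : Module.Finite R M) (φ : R →+* B) (g : M →+ B),
    HasRegularSequences R M ∧ Function.Injective g ∧ (∀ r m, g (r • m) = φ r * g m) ∧ g.range = N

open Polynomial in
/-- Adjoining a variable: `N'` is the direct sum of the `t ^ n * N`. -/
theorem IsFiniteRegularOver.adjoin {N N' : AddSubgroup B} (h : IsFiniteRegularOver N) (t : B)
    (hmem : ∀ n : ℕ, ∀ x ∈ N, t ^ n * x ∈ N')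
    (hspan : N' ≤ AddSubgroup.closure {z | ∃ n : ℕ, ∃ x ∈ N, t ^ n * x = z})
    (hind : ∀ x : ℕ →₀ B, (∀ n, x n ∈ N) → (x.sum fun n y => t ^ n * y) = 0 → x = 0) :
    IsFiniteRegularOver N' := by
  obtain ⟨R, _, _, M, _, _, _, φ, g, hreg, hinj, hsmul, rfl⟩ := h
  -- The map ∑ m_n X^n ↦ ∑ t^n g(m_n), with X acting as t. Its injectivity is `hind`; its image is
  -- determined by `hmem` and `hspan`.
  let g' : PolynomialModule R M →+ B :=
    (Finsupp.liftAddHom fun n => (AddMonoidHom.mulLeft (t ^ n)).comp g).comp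
      (PolynomialModule.coeffAddEquiv (R := R) (M := M)).toAddMonoidHom
  have hg' (x : PolynomialModule R M) : g' x = x.coeff.sum fun n m => t ^ n * g m := rfl
  have hsingle (n : ℕ) (m : M) : g' (PolynomialModule.single R n m) = t ^ n * g m := by
    rw [hg', PolynomialModule.coeff_single, Finsupp.sum_single_index (by rw [map_zero, mul_zero])]
  refine ⟨R[X], inferInstance, inferInstance, PolynomialModule R M, inferInstance, inferInstance,
    finite_polynomialModule M, eval₂RingHom φ t, g', hreg.polynomialModule, ?_, ?_, ?_⟩
  · rw [injective_iff_map_eq_zero]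
    intro x hx
    have h0 := hind (x.coeff.mapRange g (map_zero g)) (fun n => ⟨x.coeff n, rfl⟩) (by
      rw [Finsupp.sum_mapRange_index (fun n => mul_zero _)]
      exact hx)
    refine PolynomialModule.coeff_injective (Finsupp.ext fun n => hinj ?_)
    exact (DFunLike.congr_fun h0 n).trans (map_zero g).symm
  · intro r x
    induction x using PolynomialModule.induction_linear with
    | zero => rw [smul_zero, map_zero, mul_zero]
    | add x y hx hy => rw [smul_add, map_add, map_add, mul_add, hx, hy]
    | single n m =>
      induction r using Polynomial.induction_on' with
      | add p q hp hq => rw [add_smul, map_add, map_add, add_mul, hp, hq]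
      | monomial i a =>
        rw [PolynomialModule.monomial_smul_single, hsingle, hsingle, hsmul, coe_eval₂RingHom,
          eval₂_monomial, pow_add]
        ring
  · apply le_antisymm
    · rintro _ ⟨x, rfl⟩
      rw [hg']
      exact AddSubgroup.sum_mem _ fun n _ => hmem n _ ⟨_, rfl⟩
    · refine hspan.trans ((AddSubgroup.closure_le _).mpr ?_)
      rintro _ ⟨n, _, ⟨m, rfl⟩, rfl⟩
      exact ⟨_, hsingle n m⟩

theorem IsWeaklyRegularAt.map_algebraMap {R : Type*} [CommRing R] [Algebra R B] {P : Ideal B}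
    {rs : List R} (h : IsWeaklyRegularAt (P.comap (algebraMap R B)) B rs) :
    IsWeaklyRegularAt P B (rs.map (algebraMap R B)) := by
  intro i hi b hb
  have hi' : i < rs.length := by simpa using hi
  rw [← List.map_take, ← Ideal.map_ofList, smul_eq_mul, Ideal.mul_top] at hb ⊢
  rw [List.getElem_map] at hb
  obtain ⟨s, hs, hsb⟩ := h i hi' b (by
    rw [Ideal.smul_top_eq_map, Submodule.restrictScalars_mem, Algebra.smul_def]
    exact hb)
  refine ⟨algebraMap R B s, hs, ?_⟩
  rw [Ideal.smul_top_eq_map, Submodule.restrictScalars_mem, Algebra.smul_def] at hsb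
  exact hsb

/-- B is isomorphic to M over R, hence integral over R. By incomparability a prime P is minimal over
the extension of its contraction, so its height is at most that of the contraction, and the sequence
found there is long enough for P. -/
theorem IsFiniteRegularOver.isCohenMacaulayRing
    (h : IsFiniteRegularOver (⊤ : AddSubgroup B)) : IsCohenMacaulayRing B := by
  obtain ⟨R, _, _, M, _, _, _, φ, g, hreg, hinj, hsmul, hrange⟩ := h
  have hsurj : Function.Surjective g := AddMonoidHom.range_eq_top.mp hrange
  let : Algebra R B := φ.toAlgebra
  let gl : M →ₗ[R] B :=
    { toFun := g
      map_add' := map_add g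
      map_smul' := fun r m => (hsmul r m).trans (Algebra.smul_def r (g m)).symm }
  let e : M ≃ₗ[R] B := LinearEquiv.ofBijective gl ⟨hinj, hsurj⟩
  have hfin : Module.Finite R B := Module.Finite.equiv e
  have hnoeth : IsNoetherianRing B := IsNoetherianRing.of_finite R B
  refine ⟨hnoeth, fun P hP => ?_⟩
  have hPp := hP.isPrime
  obtain ⟨rs, hmem, hlen, hrs⟩ := hreg (P.comap φ) (hPp.comap φ)
  have hrsB : IsWeaklyRegularAt (P.comap (algebraMap R B)) B rs :=
    hrs.of_retract e.symm.toLinearMap e.toLinearMap e.apply_symm_apply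
  have hiff := (localDepth_eq_tfae P (Algebra.linearMap B (Localization.AtPrime P))).out 0 2
  refine hiff.mpr ⟨rs.map (algebraMap R B), ?_, ?_, hrsB.map_algebraMap⟩
  · intro b hb
    obtain ⟨a, ha, rfl⟩ := List.mem_map.mp hb
    exact hmem a ha
  · have := height_le_height_comap_add_card φ P ∅ (by simp) fun Q hQ h1 _ h2 =>
      (Ideal.IsIntegral.mem_minimalPrimes_map_under (R := R) P).2 ⟨hQ, h1⟩ h2
    rw [Finset.card_empty, Nat.cast_zero, add_zero] at this
    rw [List.length_map]
    exact this.trans hlen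

end Descent

/-! ### B as a polynomial module: hulls of full depth make B Cohen–Macaulay -/

section Structure

open MvPolynomial

variable {A : Type u} [CommRing A] {k : ℕ} {I : Fin k → Ideal A} {r : ℕ}
  {f : Fin k → A}

theorem boundedPart_eq_top {i : ℕ} (hi : k ≤ i) : boundedPart I r i = ⊤ :=
  top_le_iff.mp fun _ _ _ j hj _ => absurd (hi.trans hj) (not_le.mpr j.2)

theorem mem_of_mem_boundedPart {i : ℕ} {S : AddSubgroup (multiSymbolicRees I)}
    (hS : ∀ (n : Fin k →₀ ℕ) (c : coeffIdeal I n), (∀ j : Fin k, i ≤ j → n j < r) →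
      monomialMap I n c ∈ S) {b : multiSymbolicRees I} (hb : b ∈ boundedPart I r i) : b ∈ S := by
  rw [← sum_monomialMap_coeffMap b]
  exact AddSubgroup.sum_mem _ fun n hn => hS n _
    fun j hj => lt_of_mem_support_of_mem_boundedPart hb hn j hj

/-- The hypothesis concerns all height sequences because one and the same sequence has to serve
every component. -/
theorem isFiniteRegularOver_boundedPart_zero [IsNoetherianRing A]
    (h : ∀ (p : Ideal A), p.IsPrime → ∀ rs : List A, (∀ r ∈ rs, r ∈ p) → IsHeightSequence rs →
      ∀ n, IsWeaklyRegularAt p (coeffIdeal I n) rs) :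
    IsFiniteRegularOver (boundedPart I r 0).toAddSubgroup := by
  refine ⟨A, inferInstance, inferInstance, boundedPart I r 0, inferInstance, inferInstance,
    finite_boundedPart_zero r, algebraMap A (multiSymbolicRees I),
    (boundedPart I r 0).subtype.toAddMonoidHom, ?_, Subtype.val_injective,
    fun a b => Algebra.smul_def a (b : multiSymbolicRees I), ?_⟩
  · intro p hp
    obtain ⟨n, hn⟩ := ENat.ne_top_iff_exists.mp (Ideal.height_ne_top_of_isPrime (I := p))
    obtain ⟨rs, hlen, hmem, hrs⟩ := exists_isHeightSequence p n hn.le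
    exact ⟨rs, hmem, by rw [hlen, hn], isWeaklyRegularAt_boundedPart_zero r (h p hp rs hmem hrs)⟩
  · ext b
    exact ⟨by rintro ⟨b, rfl⟩; exact b.2, fun hb => ⟨⟨b, hb⟩, rfl⟩⟩

variable [IsDomain A]

/-- The element `f_j U_j ^ r`. -/
noncomputable def powerElement (hI : ∀ i, I i ≠ ⊥) (hf : ∀ i, f i ≠ 0)
    (hs : ∀ i, SameDual (I i ^ r) (Ideal.span {f i})) (j : Fin k) : multiSymbolicRees I :=
  monomialMap I _ ⟨f j, mem_coeffIdeal_single hI hf hs j⟩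

theorem coe_powerElement_pow (hI : ∀ i, I i ≠ ⊥) (hf : ∀ i, f i ≠ 0)
    (hs : ∀ i, SameDual (I i ^ r) (Ideal.span {f i})) (j : Fin k) (q : ℕ) :
    ((powerElement hI hf hs j ^ q : multiSymbolicRees I) : MvPolynomial (Fin k) A) =
      monomial (r • Finsupp.single j q) (f j ^ q) := by
  rw [SubmonoidClass.coe_pow, powerElement, coe_monomialMap, monomial_pow, smul_comm,
    Finsupp.smul_single, smul_eq_mul, mul_one]

theorem coeff_powerElement_pow_mul (hI : ∀ i, I i ≠ ⊥) (hf : ∀ i, f i ≠ 0)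
    (hs : ∀ i, SameDual (I i ^ r) (Ideal.span {f i})) (j : Fin k) (q : ℕ)
    (b : multiSymbolicRees I) (n : Fin k →₀ ℕ) :
    coeff n ((powerElement hI hf hs j ^ q * b : multiSymbolicRees I) : MvPolynomial (Fin k) A) =
      if r * q ≤ n j then f j ^ q * coeff (n - r • Finsupp.single j q)
        (b : MvPolynomial (Fin k) A) else 0 := by
  rw [MulMemClass.coe_mul, coe_powerElement_pow, coeff_monomial_mul']
  refine if_congr ?_ rfl rfl
  rw [Finsupp.smul_single, smul_eq_mul, Finsupp.single_le_iff]

theorem IsFiniteRegularOver.boundedPart_succ (hI : ∀ i, I i ≠ ⊥) (hf : ∀ i, f i ≠ 0)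
    (hs : ∀ i, SameDual (I i ^ r) (Ideal.span {f i})) (hr : 0 < r) {i : ℕ} (hi : i < k)
    (h : IsFiniteRegularOver (boundedPart I r i).toAddSubgroup) :
    IsFiniteRegularOver (boundedPart I r (i + 1)).toAddSubgroup := by
  classical
  set j₀ : Fin k := ⟨i, hi⟩
  refine h.adjoin (powerElement hI hf hs j₀) ?_ ?_ ?_
  · intro q x hx n j hj hn
    rw [coeff_powerElement_pow_mul]
    split_ifs
    · rw [hx _ j (by omega), mul_zero]
      have : j₀ ≠ j := by rintro rfl; simp [j₀] at hj
      simpa [Finsupp.single_apply, this] using hn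
    · rfl
  · intro b hb
    refine mem_of_mem_boundedPart (fun n c hn => AddSubgroup.subset_closure ?_) hb
    have hle : r • Finsupp.single j₀ (n j₀ / r) ≤ n := by
      rw [Finsupp.smul_single, smul_eq_mul, Finsupp.single_le_iff]
      exact Nat.mul_div_le _ _
    -- Division of the exponent of U_{j₀} by r: the quotient becomes the power of T_{j₀}, the
    -- remainder stays in e.
    obtain ⟨e, he⟩ : ∃ e, n = r • Finsupp.single j₀ (n j₀ / r) + e :=
      ⟨_, (add_tsub_cancel_of_le hle).symm⟩
    have hen (j : Fin k) : e j = n j - if j₀ = j then r * (n j₀ / r) else 0 := by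
      have := DFunLike.congr_fun he j
      simp only [Finsupp.add_apply, Finsupp.smul_apply, Finsupp.single_apply, smul_eq_mul,
        mul_ite, mul_zero] at this
      omega
    have hc : (c : A) ∈ coeffIdeal I (r • Finsupp.single j₀ (n j₀ / r) + e) := he ▸ c.2
    obtain ⟨y, hy, hyc⟩ := (mem_coeffIdeal_add_mul_iff hI hf hs _ _).mp hc
    refine ⟨n j₀ / r, monomialMap I e ⟨y, hy⟩, monomialMap_mem_boundedPart (fun j hj => ?_) _,
      Subtype.ext ?_⟩
    · rw [hen]
      split_ifs with h
      · rw [← h, ← Nat.mod_eq_sub]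
        exact Nat.mod_lt _ hr
      · have : (j : ℕ) ≠ i := fun h' => h (Fin.ext h'.symm)
        simpa using hn j (by omega)
    · rw [MulMemClass.coe_mul, coe_powerElement_pow, coe_monomialMap, coe_monomialMap,
        monomial_mul, ← he, ← hyc, prod_pow_single]
  · intro x hx hsum
    refine Finsupp.ext fun q => Subtype.ext (MvPolynomial.ext _ _ fun n => ?_)
    by_cases hn : n j₀ < r
    -- In degree n + r q e_{j₀} with n_{j₀} < r only the term T^q x_q survives: a larger power of T
    -- does not fit, and a smaller one would need an exponent of at least r in x_{q'}.
    · have h0 := congrArg (fun b : multiSymbolicRees I =>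
        coeff (n + r • Finsupp.single j₀ q) (b : MvPolynomial (Fin k) A)) hsum
      rw [Finsupp.sum, AddSubmonoidClass.coe_finsetSum, coeff_sum, Finset.sum_eq_single q] at h0
      · rw [coeff_powerElement_pow_mul, if_pos (by simp), add_tsub_cancel_right] at h0
        exact (mul_eq_zero.mp (h0.trans (coeff_zero _))).resolve_left (pow_ne_zero _ (hf _))
      · intro q' _ hqq'
        rw [coeff_powerElement_pow_mul]
        split_ifs with hle
        · have h1 : (n + r • Finsupp.single j₀ q) j₀ = n j₀ + r * q := by simp
          rw [h1] at hle
          have hlt : q' < q := by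
            refine lt_of_le_of_ne (Nat.lt_succ_iff.mp (Nat.lt_of_mul_lt_mul_left (a := r) ?_)) hqq'
            rw [Nat.mul_succ]
            omega
          rw [hx q' _ j₀ le_rfl, mul_zero]
          have h2 : (n + r • Finsupp.single j₀ q - r • Finsupp.single j₀ q') j₀ =
            n j₀ + r * q - r * q' := by simp
          rw [h2, Nat.add_sub_assoc (Nat.mul_le_mul_left _ hlt.le), ← Nat.mul_sub]
          exact le_add_left (Nat.le_mul_of_pos_right _ (Nat.sub_pos_of_lt hlt))
        · rfl
      · intro hq
        rw [Finsupp.notMem_support_iff.mp hq, mul_zero]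
        exact coeff_zero _
    · exact hx q n j₀ le_rfl (not_lt.mp hn)

/-- If all the coefficient ideals have regular sequences, the multi-symbolic Rees algebra is
Cohen–Macaulay. -/
theorem isCohenMacaulayRing_multiSymbolicRees [IsNoetherianRing A] (hI : ∀ i, I i ≠ ⊥)
    (hf : ∀ i, f i ≠ 0) (hs : ∀ i, SameDual (I i ^ r) (Ideal.span {f i})) (hr : 0 < r)
    (h : ∀ (p : Ideal A), p.IsPrime → ∀ rs : List A, (∀ r ∈ rs, r ∈ p) → IsHeightSequence rs →
      ∀ n, IsWeaklyRegularAt p (coeffIdeal I n) rs) :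
    IsCohenMacaulayRing (multiSymbolicRees I) := by
  have key (i : ℕ) (hi : i ≤ k) : IsFiniteRegularOver (boundedPart I r i).toAddSubgroup := by
    induction i with
    | zero => exact isFiniteRegularOver_boundedPart_zero h
    | succ i ih => exact (ih (by omega)).boundedPart_succ hI hf hs hr hi
  have := key k le_rfl
  rw [boundedPart_eq_top le_rfl] at this
  exact IsFiniteRegularOver.isCohenMacaulayRing this

end Structure

/-! ### From B back to the hulls: heights of primes and reduction modulo the T_j -/

theorem isPrime_span_X_image {σ A : Type*} [CommRing A] [IsDomain A] (s : Set σ) :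
    (Ideal.span (MvPolynomial.X '' s : Set (MvPolynomial σ A))).IsPrime := by
  classical
  let φ : MvPolynomial σ A →ₐ[A] MvPolynomial σ A :=
    MvPolynomial.aeval fun j => if j ∈ s then 0 else MvPolynomial.X j
  have hsub (x : MvPolynomial σ A) :
      x - φ x ∈ Ideal.span (MvPolynomial.X '' s : Set (MvPolynomial σ A)) := by
    induction x using MvPolynomial.induction_on with
    | C a =>
      rw [← MvPolynomial.algebraMap_eq, AlgHom.commutes, sub_self]
      exact zero_mem _
    | add p q hp hq => rw [map_add, add_sub_add_comm]; exact add_mem hp hq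
    | mul_X p j hp =>
      rw [map_mul, MvPolynomial.aeval_X]
      split_ifs with h
      · rw [mul_zero, sub_zero]
        exact Ideal.mul_mem_left _ _ (Ideal.subset_span ⟨j, h, rfl⟩)
      · rw [← sub_mul]
        exact Ideal.mul_mem_right _ _ hp
  have hker : Ideal.span (MvPolynomial.X '' s : Set (MvPolynomial σ A)) = RingHom.ker φ := by
    apply le_antisymm
    · refine Ideal.span_le.mpr ?_
      rintro _ ⟨j, hj, rfl⟩
      change φ _ = 0
      rw [MvPolynomial.aeval_X, if_pos hj]
    · intro x hx
      have := hsub x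
      rwa [RingHom.mem_ker.mp hx, sub_zero] at this
  rw [hker]
  exact RingHom.ker_isPrime φ

/-- A chain of primes below q pulls back to a strict chain of primes above the kernel. -/
theorem height_ker_add_le_height_comap {A B : Type*} [CommRing A] [IsDomain A] [CommRing B]
    (ε : B →+* A) (hε : Function.Surjective ε) (n : ℕ) (q : Ideal A) [q.IsPrime]
    (hn : (n : ℕ∞) ≤ q.height) : (RingHom.ker ε).height + n ≤ (q.comap ε).height := by
  induction n generalizing q with
  | zero =>
    rw [Nat.cast_zero, add_zero]
    exact Ideal.height_mono (Ideal.comap_mono bot_le)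
  | succ n ih =>
    obtain ⟨q', hq', hlt, hle⟩ : ∃ q' : Ideal A, q'.IsPrime ∧ q' < q ∧ (n : ℕ∞) ≤ q'.height := by
      by_contra! h
      have := hn.trans (Ideal.height_le_iff.mpr h)
      norm_cast at this
      omega
    have hlt' : q'.comap ε < q.comap ε := by
      refine lt_of_le_of_ne (Ideal.comap_mono hlt.le) fun h => hlt.ne ?_
      exact Ideal.comap_injective_of_surjective ε hε h
    refine le_trans ?_ (Ideal.height_add_one_le_of_lt_of_isPrime hlt')
    rw [Nat.cast_add, Nat.cast_one, ← add_assoc]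
    exact add_le_add_left (ih q' hle) 1

theorem IsCohenMacaulayRing.isWeaklyRegularAt {B : Type u} [CommRing B] (h : IsCohenMacaulayRing B)
    {P : Ideal B} (hP : P.IsMaximal) {rs : List B} (hmem : ∀ r ∈ rs, r ∈ P)
    (hrs : IsHeightSequence rs) : IsWeaklyRegularAt P B rs := by
  have := h.noetherian
  have hiff := (localDepth_eq_tfae P (Algebra.linearMap B (Localization.AtPrime P))).out 0 1
  exact hiff.mp (h.depth_eq P) rs hmem hrs

section Converse

open MvPolynomial

variable {A : Type u} [CommRing A] {k : ℕ} {I : Fin k → Ideal A} {r : ℕ} {f : Fin k → A}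

/-- The ideal of the elements all of whose monomials involve one of the first `i` variables. -/
noncomputable def variableIdeal (I : Fin k → Ideal A) (i : ℕ) : Ideal (multiSymbolicRees I) :=
  (Ideal.span (X '' {j : Fin k | (j : ℕ) < i})).comap (multiSymbolicRees I).val.toRingHom

theorem mem_variableIdeal {i : ℕ} {b : multiSymbolicRees I} : b ∈ variableIdeal I i ↔
    ∀ n ∈ (b : MvPolynomial (Fin k) A).support, ∃ j : Fin k, (j : ℕ) < i ∧ n j ≠ 0 :=
  mem_ideal_span_X_image

theorem variableIdeal_mono {i i' : ℕ} (h : i ≤ i') : variableIdeal I i ≤ variableIdeal I i' :=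
  fun _ hb => mem_variableIdeal.mpr fun n hn =>
    let ⟨j, hj, hnj⟩ := mem_variableIdeal.mp hb n hn
    ⟨j, hj.trans_le h, hnj⟩

variable (I) in
/-- The projection of the multi-symbolic Rees algebra to its component of degree zero. -/
noncomputable def augmentation : multiSymbolicRees I →+* A :=
  constantCoeff.comp (multiSymbolicRees I).val.toRingHom

theorem augmentation_apply (b : multiSymbolicRees I) :
    augmentation I b = coeff 0 (b : MvPolynomial (Fin k) A) := rfl

theorem augmentation_algebraMap (a : A) : augmentation I (algebraMap A _ a) = a :=
  constantCoeff_C _ a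

theorem augmentation_surjective : Function.Surjective (augmentation I) :=
  fun a => ⟨_, augmentation_algebraMap a⟩

theorem ker_augmentation : RingHom.ker (augmentation I) = variableIdeal I k := by
  ext b
  rw [RingHom.mem_ker, augmentation_apply, mem_variableIdeal, ← notMem_support_iff]
  constructor
  · intro h n hn
    by_contra! h'
    have : n = 0 := Finsupp.ext fun j => h' j j.2
    exact h (this ▸ hn)
  · intro h h0
    obtain ⟨j, -, hj⟩ := h 0 h0
    exact hj rfl

/-- Let ε be the augmentation. The difference ε(s) − s is nilpotent modulo T, so some power of ε(s)
is a multiple of s modulo T. This replaces a multiplier from B by one from A. -/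
theorem exists_mem_sup_of_notMem_comap_augmentation {m : Ideal A} [m.IsPrime]
    {T J : Ideal (multiSymbolicRees I)} (hT : variableIdeal I k ≤ T.radical)
    {s b : multiSymbolicRees I} (hs : s ∉ m.comap (augmentation I)) (hsb : s * b ∈ T ⊔ J) :
    ∃ a ∉ m, algebraMap A _ a * b ∈ T ⊔ J := by
  have hker : algebraMap A _ (augmentation I s) - s ∈ variableIdeal I k := by
    rw [← ker_augmentation, RingHom.mem_ker, map_sub, augmentation_algebraMap, sub_self]
  obtain ⟨N, hN⟩ := hT hker
  refine ⟨augmentation I s ^ N, fun h => hs (Ideal.IsPrime.mem_of_pow_mem (I := m) ‹_› _ h), ?_⟩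
  obtain ⟨c, hc⟩ := sub_dvd_pow_sub_pow (algebraMap A (multiSymbolicRees I) (augmentation I s))
    (algebraMap A _ (augmentation I s) - s) N
  rw [sub_sub_cancel, sub_eq_iff_eq_add] at hc
  rw [map_pow, hc, add_mul, mul_right_comm]
  exact add_mem (Ideal.mul_mem_right _ _ hsb)
    (Ideal.mem_sup_left (Ideal.mul_mem_right _ _ hN))

variable [IsDomain A]

instance (i : ℕ) : (variableIdeal I i).IsPrime :=
  (isPrime_span_X_image _).comap _

theorem powerElement_mem_variableIdeal (hI : ∀ i, I i ≠ ⊥) (hf : ∀ i, f i ≠ 0)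
    (hs : ∀ i, SameDual (I i ^ r) (Ideal.span {f i})) (hr : 0 < r) (j : Fin k) (i : ℕ) :
    powerElement hI hf hs j ∈ variableIdeal I i ↔ (j : ℕ) < i := by
  classical
  have hsupp : ((powerElement hI hf hs j : multiSymbolicRees I) :
      MvPolynomial (Fin k) A).support = {r • Finsupp.single j 1} := by
    rw [powerElement, coe_monomialMap]
    exact support_monomial.trans (if_neg (hf j))
  rw [mem_variableIdeal, hsupp]
  simp only [Finset.mem_singleton, forall_eq]
  constructor
  · rintro ⟨j', hj', h⟩
    by_contra hj
    refine h ?_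
    rw [Finsupp.smul_apply, Finsupp.single_eq_of_ne, smul_zero]
    rintro rfl
    exact hj hj'
  · exact fun h => ⟨j, h, by simpa using hr.ne'⟩

/-- The variable ideals form a chain of primes, and each inclusion is strict because of the next
T_j. -/
theorem le_height_variableIdeal (hI : ∀ i, I i ≠ ⊥) (hf : ∀ i, f i ≠ 0)
    (hs : ∀ i, SameDual (I i ^ r) (Ideal.span {f i})) (hr : 0 < r) {i : ℕ} (hi : i ≤ k) :
    (i : ℕ∞) ≤ (variableIdeal I i).height := by
  induction i with
  | zero => simp
  | succ i ih =>
    have hlt : variableIdeal I i < variableIdeal I (i + 1) := by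
      refine lt_of_le_not_ge (variableIdeal_mono i.le_succ) fun h => ?_
      have := h ((powerElement_mem_variableIdeal hI hf hs hr ⟨i, hi⟩ _).mpr i.lt_succ_self)
      rw [powerElement_mem_variableIdeal] at this
      · exact lt_irrefl _ this
      · exact hr
    rw [Nat.cast_add, Nat.cast_one]
    exact (add_le_add_left (ih (by omega)) 1).trans
      (Ideal.height_add_one_le_of_lt_of_isPrime hlt)

/-- By periodicity the component of degree r n is f^n A, so it consists of A-multiples of T^n. Hence
the T_j generate the variable ideals up to radical. -/
theorem exists_monomialMap_pow_eq (hI : ∀ i, I i ≠ ⊥) (hf : ∀ i, f i ≠ 0)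
    (hs : ∀ i, SameDual (I i ^ r) (Ideal.span {f i})) (n : Fin k →₀ ℕ) (c : coeffIdeal I n) :
    ∃ b, monomialMap I n c ^ r = (∏ j, powerElement hI hf hs j ^ n j) * b := by
  have hpow (m : ℕ) : (c : A) ^ m ∈ coeffIdeal I (m • n) := by
    induction m with
    | zero => rw [zero_smul]; exact mem_coeffIdeal_zero _
    | succ m ih =>
      have := mul_mem_reflexiveHull ih c.2
      rw [← Finset.prod_mul_distrib] at this
      simp only [← pow_add] at this
      rwa [pow_succ, succ_nsmul]
  have hc := hpow r
  rw [← add_zero (r • n)] at hc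
  obtain ⟨y, -, hy⟩ := (mem_coeffIdeal_add_mul_iff hI hf hs 0 n).mp hc
  refine ⟨algebraMap A _ y, Subtype.ext ?_⟩
  have hprod : ((∏ j, powerElement hI hf hs j ^ n j : multiSymbolicRees I) :
      MvPolynomial (Fin k) A) = monomial (r • n) (∏ j, f j ^ n j) := by
    rw [SubmonoidClass.coe_finsetProd]
    simp only [coe_powerElement_pow]
    have key (s : Finset (Fin k)) : ∏ j ∈ s, monomial (r • Finsupp.single j (n j)) (f j ^ n j) =
        monomial (∑ j ∈ s, r • Finsupp.single j (n j)) (∏ j ∈ s, f j ^ n j) := by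
      classical
      induction s using Finset.induction_on with
      | empty => rfl
      | insert j s hj ih =>
        rw [Finset.prod_insert hj, ih, monomial_mul, Finset.sum_insert hj, Finset.prod_insert hj]
    rw [key, ← Finset.smul_sum, Finsupp.univ_sum_single]
  rw [MulMemClass.coe_mul, hprod, SubmonoidClass.coe_pow, coe_monomialMap, monomial_pow, ← hy]
  change _ = _ * C y
  rw [mul_comm _ (C y), C_mul_monomial, mul_comm y]

theorem variableIdeal_le_radical (hI : ∀ i, I i ≠ ⊥) (hf : ∀ i, f i ≠ 0)
    (hs : ∀ i, SameDual (I i ^ r) (Ideal.span {f i})) {i : ℕ} {Q : Ideal (multiSymbolicRees I)}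
    (hQ : ∀ j : Fin k, (j : ℕ) < i → powerElement hI hf hs j ∈ Q) :
    variableIdeal I i ≤ Q.radical := by
  intro b hb
  rw [← sum_monomialMap_coeffMap b]
  refine Ideal.sum_mem _ fun n hn => ?_
  obtain ⟨j, hj, hnj⟩ := mem_variableIdeal.mp hb n hn
  obtain ⟨c, hc⟩ := exists_monomialMap_pow_eq hI hf hs n (coeffMap I n b)
  refine ⟨r, ?_⟩
  rw [hc]
  refine Ideal.mul_mem_right _ _ ?_
  rw [← Finset.mul_prod_erase _ _ (Finset.mem_univ j)]
  exact Ideal.mul_mem_right _ _ (Ideal.pow_mem_of_mem _ (hQ j hj) _ (Nat.pos_of_ne_zero hnj))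

/-- A prime over the first i ≤ k of the T_j contains the i-th variable ideal. A prime over all of
them contains the kernel of the augmentation, so it contains the preimage of its contraction to A,
and the heights of the kernel and of that contraction add up. -/
theorem IsHeightSequence.ofFn_powerElement_append (hI : ∀ i, I i ≠ ⊥) (hf : ∀ i, f i ≠ 0)
    (hs : ∀ i, SameDual (I i ^ r) (Ideal.span {f i})) (hr : 0 < r) {rs : List A}
    (h : IsHeightSequence rs) :
    IsHeightSequence (List.ofFn (powerElement hI hf hs) ++
      rs.map (algebraMap A (multiSymbolicRees I))) := by
  intro i hi Q hQ hle
  have hlen : (List.ofFn (powerElement hI hf hs)).length = k := List.length_ofFn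
  have hT (j : Fin k) (hj : (j : ℕ) < i) : powerElement hI hf hs j ∈ Q := by
    refine hle (Ideal.subset_span ?_)
    change _ ∈ List.take i _
    rw [List.take_append, List.mem_append]
    left
    rw [List.mem_take_iff_getElem]
    exact ⟨j, by rw [hlen]; exact lt_min hj j.2, by simp⟩
  rcases le_total i k with hik | hki
  · have := variableIdeal_le_radical hI hf hs hT
    rw [hQ.radical] at this
    exact (le_height_variableIdeal hI hf hs hr hik).trans (Ideal.height_mono this)
  · obtain ⟨d, rfl⟩ := Nat.exists_eq_add_of_le hki
    have hker := variableIdeal_le_radical hI hf hs (i := k) fun j _ => hT j (by omega)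
    rw [hQ.radical, ← ker_augmentation] at hker
    have hqp : (Q.comap (algebraMap A (multiSymbolicRees I))).IsPrime := hQ.comap _
    have hQc : (Q.comap (algebraMap A (multiSymbolicRees I))).comap (augmentation I) ≤ Q := by
      intro b hb
      have h1 : b - algebraMap A _ (augmentation I b) ∈ Q := hker (by
        rw [RingHom.mem_ker, map_sub, augmentation_algebraMap, sub_self])
      have := add_mem h1 (show algebraMap A _ (augmentation I b) ∈ Q from hb)
      rwa [sub_add_cancel] at this
    have hd : (d : ℕ∞) ≤ (Q.comap (algebraMap A (multiSymbolicRees I))).height := by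
      refine h d (by simpa using hi) _ hqp ?_
      rw [← Ideal.map_le_iff_le_comap, Ideal.map_ofList]
      refine le_trans (Ideal.span_mono fun x hx => ?_) hle
      change x ∈ List.take _ _
      rw [List.take_append, hlen, Nat.add_sub_cancel_left, ← List.map_take]
      exact List.mem_append_right _ hx
    refine le_trans ?_ (Ideal.height_mono hQc)
    refine le_trans ?_ (height_ker_add_le_height_comap _ augmentation_surjective d _ hd)
    rw [ker_augmentation, Nat.cast_add]
    exact add_le_add_left (le_height_variableIdeal hI hf hs hr le_rfl) _

/-- A multiple of T_j has no monomial whose exponent at U_j is below r, so the coefficient map in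
degree n factors through B/(T). -/
theorem coeffMap_mem_smul_top (hI : ∀ i, I i ≠ ⊥) (hf : ∀ i, f i ≠ 0)
    (hs : ∀ i, SameDual (I i ^ r) (Ideal.span {f i})) {n : Fin k →₀ ℕ} (hn : ∀ j, n j < r)
    {J : Ideal A} {b : multiSymbolicRees I}
    (hb : b ∈ Ideal.ofList (List.ofFn (powerElement hI hf hs)) ⊔ J.map (algebraMap A _)) :
    coeffMap I n b ∈ J • (⊤ : Submodule A (coeffIdeal I n)) := by
  obtain ⟨x, hx, y, hy, rfl⟩ := Submodule.mem_sup.mp hb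
  clear hb
  have hx0 (c : multiSymbolicRees I) : coeffMap I n (c * x) = 0 := by
    induction hx using Submodule.span_induction generalizing c with
    | mem x hx =>
      obtain ⟨j, rfl⟩ := (List.mem_ofFn' _ _).mp hx
      apply Subtype.ext
      have := coeff_powerElement_pow_mul hI hf hs j 1 c n
      rw [pow_one, mul_one, if_neg (not_le.mpr (hn j)), mul_comm] at this
      exact this
    | zero => rw [mul_zero, map_zero]
    | add x y _ _ hx hy => rw [mul_add, map_add, hx, hy, add_zero]
    | smul a x _ hx => rw [smul_eq_mul, ← mul_assoc]; exact hx _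
  have hx1 := hx0 1
  rw [one_mul] at hx1
  rw [map_add, hx1, zero_add]
  refine map_mem_smul_top (coeffMap I n) ?_
  rw [Ideal.smul_top_eq_map]
  exact hy

theorem isWeaklyRegularAt_coeffIdeal_of_lt (hI : ∀ i, I i ≠ ⊥) (hf : ∀ i, f i ≠ 0)
    (hs : ∀ i, SameDual (I i ^ r) (Ideal.span {f i})) {m : Ideal A} [m.IsPrime] {rs : List A}
    (hrs : IsWeaklyRegularAt (m.comap (augmentation I)) (multiSymbolicRees I)
      (List.ofFn (powerElement hI hf hs) ++ rs.map (algebraMap A (multiSymbolicRees I))))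
    {n : Fin k →₀ ℕ} (hn : ∀ j, n j < r) : IsWeaklyRegularAt m (coeffIdeal I n) rs := by
  intro i hi x hx
  have hlen : (List.ofFn (powerElement hI hf hs)).length = k := List.length_ofFn
  have htake : (List.ofFn (powerElement hI hf hs) ++
      rs.map (algebraMap A (multiSymbolicRees I))).take (k + i) =
      List.ofFn (powerElement hI hf hs) ++
        (rs.take i).map (algebraMap A (multiSymbolicRees I)) := by
    rw [List.take_append, hlen, Nat.add_sub_cancel_left, ← List.map_take,
      List.take_of_length_le (by omega)]
  have h := hrs (k + i) (by simpa using hi) (monomialMap I n x)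
  rw [htake, Ideal.ofList_append, ← Ideal.map_ofList, smul_eq_mul, Ideal.mul_top,
    List.getElem_append_right (by omega)] at h
  simp only [hlen, Nat.add_sub_cancel_left, List.getElem_map] at h
  obtain ⟨s, hsm, hsx⟩ := h (by
    refine Ideal.mem_sup_right ?_
    have := map_mem_smul_top (monomialMap I n) hx
    rwa [map_smul, Ideal.smul_top_eq_map, Submodule.restrictScalars_mem,
      Algebra.smul_def] at this)
  obtain ⟨a, ha, hax⟩ := exists_mem_sup_of_notMem_comap_augmentation
    (variableIdeal_le_radical hI hf hs fun j _ =>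
      Ideal.subset_span ((List.mem_ofFn' _ _).mpr ⟨j, rfl⟩)) hsm hsx
  refine ⟨a, ha, ?_⟩
  have := coeffMap_mem_smul_top hI hf hs hn hax
  rwa [← Algebra.smul_def, map_smul, coeffMap_monomialMap] at this

/-- Division of all exponents by r: multiplication by f^e is an isomorphism from the component of
the remainders. -/
theorem isWeaklyRegularAt_coeffIdeal (hI : ∀ i, I i ≠ ⊥) (hf : ∀ i, f i ≠ 0)
    (hs : ∀ i, SameDual (I i ^ r) (Ideal.span {f i})) (hr : 0 < r) {m : Ideal A} {rs : List A}
    (hrs : ∀ n : Fin k →₀ ℕ, (∀ j, n j < r) → IsWeaklyRegularAt m (coeffIdeal I n) rs)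
    (n : Fin k →₀ ℕ) : IsWeaklyRegularAt m (coeffIdeal I n) rs := by
  set e : Fin k →₀ ℕ := n.mapRange (· / r) (Nat.zero_div r)
  set n' : Fin k →₀ ℕ := n.mapRange (· % r) (Nat.zero_mod r)
  have hn : n = r • e + n' := by
    ext j
    simp [e, n', Nat.div_add_mod]
  have hfe : ∏ i, f i ^ e i ≠ 0 := Finset.prod_ne_zero_iff.mpr fun i _ => pow_ne_zero _ (hf i)
  let g : coeffIdeal I n' →ₗ[A] coeffIdeal I n :=
    { toFun := fun x => ⟨(∏ i, f i ^ e i) * x, by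
        rw [hn]
        exact (mem_coeffIdeal_add_mul_iff hI hf hs n' e).mpr ⟨x, x.2, rfl⟩⟩
      map_add' := fun x y => Subtype.ext (mul_add _ _ _)
      map_smul' := fun c x => Subtype.ext (mul_left_comm _ _ _) }
  have hg : Function.Bijective g := by
    constructor
    · intro x y h
      exact Subtype.ext (mul_left_cancel₀ hfe (congrArg Subtype.val h))
    · rintro ⟨x, hx⟩
      have hx' := hx
      rw [hn] at hx'
      obtain ⟨y, hy, rfl⟩ := (mem_coeffIdeal_add_mul_iff hI hf hs n' e).mp hx'
      exact ⟨⟨y, hy⟩, rfl⟩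
  let E := LinearEquiv.ofBijective g hg
  exact (hrs n' fun j => Nat.mod_lt _ hr).of_retract E.symm.toLinearMap E.toLinearMap
    E.apply_symm_apply

end Converse

section Localized

variable {A : Type u} [CommRing A] [IsDomain A]

theorem nontrivial_localizedModule_reflexiveHull {J : Ideal A} (hJ : J ≠ ⊥) (p : Ideal A)
    [p.IsPrime] : Nontrivial (LocalizedModule p.primeCompl (reflexiveHull J)) := by
  obtain ⟨x, hx, hx0⟩ := (Submodule.ne_bot_iff J).mp hJ
  refine ⟨LocalizedModule.mkLinearMap p.primeCompl _ ⟨x, le_reflexiveHull J hx⟩, 0, fun h => ?_⟩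
  obtain ⟨c, hc⟩ := (IsLocalizedModule.eq_zero_iff p.primeCompl _).mp h
  have hc' : (c : A) * x = 0 := congrArg Subtype.val hc
  rcases mul_eq_zero.mp hc' with h | h
  · exact c.2 (h ▸ zero_mem p)
  · exact hx0 h

end Localized

end SymbolicRees

/-! ### The theorem -/

theorem mainTheorem4 {A : Type*} [CommRing A] [IsDomain A] [IsNoetherianRing A]
    [IsIntegrallyClosed A] {k : ℕ} (I : Fin k → Ideal A)
    (hI : ∀ i, SymbolicRees.IsPureHeightOne (I i))
    (hfin : ∀ i, IsOfFinOrder (SymbolicRees.divisorClass (I i) (hI i).ne_bot)) :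
    SymbolicRees.IsCohenMacaulayRing (SymbolicRees.multiSymbolicRees I) ↔
      ∀ n : Fin k → ℕ, SymbolicRees.IsMaximalCohenMacaulay A
        (SymbolicRees.reflexiveHull (∏ i, I i ^ n i)) := by
  have hbot := fun i => (hI i).ne_bot
  obtain ⟨r, hr, f, hf, hs⟩ := SymbolicRees.exists_common_pow_sameDual I hbot hfin
  have hne (n : Fin k → ℕ) (p : Ideal A) [p.IsPrime] :
      Nontrivial (LocalizedModule p.primeCompl (SymbolicRees.reflexiveHull (∏ i, I i ^ n i))) :=
    SymbolicRees.nontrivial_localizedModule_reflexiveHull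
      (Finset.prod_ne_zero_iff.mpr fun i _ => pow_ne_zero _ (hbot i)) p
  constructor
  · intro h n
    refine ⟨inferInstance, fun m hm => ?_⟩
    have hnt := hne n m
    refine ⟨hnt, inferInstance, ?_⟩
    have hM : (m.comap (SymbolicRees.augmentation I)).IsMaximal :=
      Ideal.comap_isMaximal_of_surjective _ SymbolicRees.augmentation_surjective
    have hA := (SymbolicRees.localDepth_eq_tfae m (LocalizedModule.mkLinearMap m.primeCompl
      (SymbolicRees.reflexiveHull (∏ i, I i ^ n i)))).out 0 1
    refine hA.mpr fun rs hmem hrs => ?_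
    refine SymbolicRees.isWeaklyRegularAt_coeffIdeal hbot hf hs hr (fun n hn =>
      SymbolicRees.isWeaklyRegularAt_coeffIdeal_of_lt hbot hf hs
        (h.isWeaklyRegularAt hM ?_ (hrs.ofFn_powerElement_append hbot hf hs hr)) hn)
      (Finsupp.equivFunOnFinite.symm n)
    intro b hb
    rw [Ideal.mem_comap]
    rcases List.mem_append.mp hb with hb | hb
    · obtain ⟨j, rfl⟩ := (List.mem_ofFn' _ _).mp hb
      have : SymbolicRees.powerElement hbot hf hs j ∈
          RingHom.ker (SymbolicRees.augmentation I) := by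
        rw [SymbolicRees.ker_augmentation, SymbolicRees.powerElement_mem_variableIdeal _ _ _ hr]
        exact j.2
      rw [RingHom.mem_ker.mp this]
      exact zero_mem m
    · obtain ⟨a, ha, rfl⟩ := List.mem_map.mp hb
      rw [SymbolicRees.augmentation_algebraMap]
      exact hmem a ha
  · intro h
    refine SymbolicRees.isCohenMacaulayRing_multiSymbolicRees hbot hf hs hr
      fun p hp rs hmem hrs n => ?_
    -- Full depth is known only at maximal ideals. A height sequence in p is also one in m, and
    -- regularity at m passes to the smaller prime p.
    obtain ⟨m, hm, hpm⟩ := p.exists_le_maximal hp.ne_top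
    have hnt := hne n m
    have hA := (SymbolicRees.localDepth_eq_tfae m (LocalizedModule.mkLinearMap m.primeCompl
      (SymbolicRees.reflexiveHull (∏ i, I i ^ n i)))).out 0 1
    exact (hA.mp ((h n).localized m).depth_eq rs (fun r hr => hpm (hmem r hr)) hrs).mono hpm
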